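/- Let $T\ge 1$ and let $(a_n),(b_n)$ be real $T$-periodic sequences with $a_n>0$ for all $n$ (so $a_0=a_T$). Let $J_T$ be the Jacobi operator on $\ell^2(\mathbb N;\mathbb C)$, $\mathbb N=\{1,2,\dots\}$, given by $(J_Tu)_1=b_1u_1+a_1u_2$ and $(J_Tu)_n=a_{n-1}u_{n-1}+b_nu_n+a_nu_{n+1}$ for $n\ge 2$. For $\lambda\in\mathbb C$ put $$B_i(\lambda)=\begin{pmatrix}0&1\\ -\frac{a_{i-1}}{a_i}&\frac{\lambda-b_i}{a_i}\end{pmatrix},\qquad M(\lambda)=B_T(\lambda)\cdots B_1(\lambda).$$ The point $\lambda$ is called elliptic if $M(\lambda)$ has two distinct eigenvalues of modulus one (such $\lambda$ are real); its quasi-momentum is the number $\theta=\theta(\lambda)\in(0,\pi)$ such that the eigenvalues of $M(\lambda)$ are $e^{\pm i\theta}$. For elliptic $\lambda$ and $0\le j\le T-1$ let $\mu=e^{i\theta}$, let $(p_1,p_2)$ be the first row of $M(\lambda)$, let $(\alpha_2^{(j)},\alpha_4^{(j)})^{\mathsf T}$ be the second column of $B_T(\lambda)\cdots B_{T-j+1}(\lambda)$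 and $(\tilde\alpha_3^{(j)},\tilde\alpha_4^{(j)})$ the second row of $B_{T-j-1}(\lambda)\cdots B_1(\lambda)$ (empty products are the identity matrix), and put $$D_j=\frac{|\mu-p_1|^2\mu}{2p_2}\Bigl(\tilde\alpha_3^{(j)}\frac{p_2}{\mu-p_1}+\tilde\alpha_4^{(j)}\Bigr)\Bigl(-\alpha_2^{(j)}+\alpha_4^{(j)}\frac{p_2}{\mu-p_1}\Bigr),\qquad E_j=\frac{D_j}{2Ta_{T-j}}.$$ Let $\lambda$ be elliptic with $\theta(\lambda)\ne\frac{\pi}{2}$, let $\omega\in\mathbb R$ and $k_+\in\mathbb Z$ satisfy $\omega T+2\theta(\lambda)=2\pi k_+$, let $\phi\in\mathbb R$ be arbitrary, and assume that $$E(\lambda;k_+):=\sum_{j=0}^{T-1}E_j\,e^{i((T-j)\omega+\phi)}\neq 0 .$$ Then there are a real constant $c\neq 0$ and real numbers $q_1,q_2$ such that, with $$q_n=\frac{c\,\sin(n\omega+\phi)}{n}\quad (n\ge 3)$$ and with $Q$ the diagonal operator on $\ell^2(\mathbb N;\mathbb C)$ with diagonal entries $q_1,q_2,q_3,\dots$,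 the number $\lambda$ is an eigenvalue of $J_T+Q$, that is, $\lambda\in\sigma_p(J_T+Q)$. -/

import Mathlib

namespace JacobiWvN

noncomputable section

/-- The Hilbert space `ℓ²(ℕ; ℂ)`. The coordinate `n = 0, 1, 2, …` of a vector is the entry that is
written `u_{n+1}` when sequences are indexed from `1`. -/
abbrev EllTwo : Type := lp (fun _ : ℕ => ℂ) 2

/-- A real sequence multiplies `ℓ²` into itself if it is bounded. -/
theorem memlp_mul {d : ℕ → ℝ} (hd : ∃ C, ∀ n, |d n| ≤ C) {u : ℕ → ℂ} (hu : Memℓp u 2) :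
    Memℓp (fun n => (d n : ℂ) * u n) 2 := by
  obtain ⟨C, hC⟩ := hd
  have h0 : (0 : ℝ) < (2 : ENNReal).toReal := by norm_num
  rw [memℓp_gen_iff h0] at hu ⊢
  refine Summable.of_nonneg_of_le (fun n => by positivity) (fun n => ?_)
    (hu.mul_left (C ^ (2 : ENNReal).toReal))
  rw [norm_mul, Real.mul_rpow (norm_nonneg _) (norm_nonneg _)]
  have : ‖(d n : ℂ)‖ ≤ C := by simpa using hC n
  gcongr

/-- The multiplication operator on `ℓ²(ℕ)` by a bounded real sequence: the diagonal matrix with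
diagonal `d 0, d 1, d 2, …`. -/
def diagonalOp (d : ℕ → ℝ) (hd : ∃ C, ∀ n, |d n| ≤ C) : Module.End ℂ EllTwo where
  toFun u := ⟨fun n => (d n : ℂ) * u n, memlp_mul hd u.2⟩
  map_add' u v := by
    ext n
    exact mul_add _ _ _
  map_smul' z u := by
    ext n
    exact mul_left_comm _ _ _

theorem memlp_tail {u : ℕ → ℂ} (hu : Memℓp u 2) : Memℓp (fun n => u (n + 1)) 2 := by
  have h0 : (0 : ℝ) < (2 : ENNReal).toReal := by norm_num
  rw [memℓp_gen_iff h0] at hu ⊢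
  exact (summable_nat_add_iff 1).2 hu

theorem memlp_shift {u : ℕ → ℂ} (hu : Memℓp u 2) :
    Memℓp (fun n => if n = 0 then 0 else u (n - 1)) 2 := by
  have h0 : (0 : ℝ) < (2 : ENNReal).toReal := by norm_num
  rw [memℓp_gen_iff h0] at hu ⊢
  refine (summable_nat_add_iff 1).1 ?_
  simpa using hu

variable {T : ℕ} [NeZero T]

theorem bounded_periodic (a : ZMod T → ℝ) (f : ℕ → ZMod T) : ∃ C, ∀ n, |a (f n)| ≤ C :=
  ⟨∑ i, |a i|, fun _ =>
    Finset.single_le_sum (f := fun i => |a i|) (fun _ _ => abs_nonneg _) (Finset.mem_univ _)⟩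

theorem memlp_jacobi (a b : ZMod T → ℝ) {u : ℕ → ℂ} (hu : Memℓp u 2) :
    Memℓp (fun n : ℕ =>
      (if n = 0 then 0 else (a (n : ZMod T) : ℂ) * u (n - 1))
        + (b ((n + 1 : ℕ) : ZMod T) : ℂ) * u n
        + (a ((n + 1 : ℕ) : ZMod T) : ℂ) * u (n + 1)) 2 := by
  have h1 := memlp_mul (bounded_periodic a fun n => (n : ZMod T)) (memlp_shift hu)
  have h2 := memlp_mul (bounded_periodic b fun n => ((n + 1 : ℕ) : ZMod T)) hu
  have h3 := memlp_mul (bounded_periodic a fun n => ((n + 1 : ℕ) : ZMod T)) (memlp_tail hu)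
  simp only [mul_ite, mul_zero] at h1
  exact (h1.add h2).add h3

/-- The period-`T` Jacobi operator `J_T` on `ℓ²(ℕ)` with off-diagonal entries `a_1, a_2, …` and
diagonal entries `b_1, b_2, …`, where `a_n`, `b_n` depend on `n` modulo `T` only:
in indices starting from `1`, `(J_T u)_n = a_{n-1} u_{n-1} + b_n u_n + a_n u_{n+1}` for `n ≥ 2`, and
`(J_T u)_1 = b_1 u_1 + a_1 u_2`. -/
def periodicJacobi (a b : ZMod T → ℝ) : Module.End ℂ EllTwo where
  toFun u :=
    ⟨fun n =>
      (if n = 0 then 0 else (a (n : ZMod T) : ℂ) * u (n - 1))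
        + (b ((n + 1 : ℕ) : ZMod T) : ℂ) * u n
        + (a ((n + 1 : ℕ) : ZMod T) : ℂ) * u (n + 1),
      memlp_jacobi a b u.2⟩
  map_add' u v := by
    ext n
    simp only [lp.coeFn_add, Pi.add_apply]
    split_ifs
    · ring
    · ring
  map_smul' z u := by
    ext n
    simp only [lp.coeFn_smul, Pi.smul_apply, smul_eq_mul, RingHom.id_apply]
    split_ifs
    · ring
    · ring

/-- The transfer matrix `B_i(λ)`; the index of `a` and `b` is read modulo `T`, so `a_0 = a_T`. -/
def transferMatrix (a b : ZMod T → ℝ) (lam : ℂ) (i : ℕ) : Matrix (Fin 2) (Fin 2) ℂ :=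
  !![0, 1;
    -(a ((i : ZMod T) - 1) : ℂ) / (a (i : ZMod T) : ℂ),
    (lam - (b (i : ZMod T) : ℂ)) / (a (i : ZMod T) : ℂ)]

/-- The product `B_{s+m}(λ) ⋯ B_{s+2}(λ) B_{s+1}(λ)` of `m` transfer matrices (the identity matrix
for `m = 0`). -/
def transferProd (a b : ZMod T → ℝ) (lam : ℂ) (s : ℕ) : ℕ → Matrix (Fin 2) (Fin 2) ℂ
  | 0 => 1
  | m + 1 => transferMatrix a b lam (s + m + 1) * transferProd a b lam s m

/-- The monodromy matrix `M(λ) = B_T(λ) ⋯ B_1(λ)`. -/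
def monodromy (a b : ZMod T → ℝ) (lam : ℂ) : Matrix (Fin 2) (Fin 2) ℂ :=
  transferProd a b lam 0 T

/-- The set `σ_ell(J_T)` of elliptic points: those `λ ∈ ℂ` for which the monodromy matrix has two
distinct eigenvalues of modulus one. -/
def ellipticPoints (a b : ZMod T → ℝ) : Set ℂ :=
  {lam | ∃ μ₁ μ₂ : ℂ, μ₁ ≠ μ₂ ∧ ‖μ₁‖ = 1 ∧ ‖μ₂‖ = 1 ∧
    Module.End.HasEigenvalue (Matrix.toLin' (monodromy a b lam)) μ₁ ∧
    Module.End.HasEigenvalue (Matrix.toLin' (monodromy a b lam)) μ₂}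

/-- `θ` is the quasi-momentum at `λ`: `0 < θ < π`, and `e^{iθ}`, `e^{-iθ}` are the eigenvalues of the
monodromy matrix. -/
def IsQuasiMomentum (a b : ZMod T → ℝ) (lam : ℂ) (θ : ℝ) : Prop :=
  0 < θ ∧ θ < Real.pi ∧
    Module.End.HasEigenvalue (Matrix.toLin' (monodromy a b lam)) (Complex.exp (Complex.I * θ)) ∧
    Module.End.HasEigenvalue (Matrix.toLin' (monodromy a b lam)) (Complex.exp (-(Complex.I * θ)))

/-- The coefficient `D_j(λ)`, for `0 ≤ j < T`. With `μ = e^{iθ}`, with `p₁, p₂` the first row of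
`M(λ)`, with `α₂, α₄` the second column of `B_T ⋯ B_{T-j+1}` and `α̃₃, α̃₄` the second row of
`B_{T-j-1} ⋯ B_1`, it is
`|μ - p₁|² μ / (2 p₂) · (α̃₃ p₂ / (μ - p₁) + α̃₄) · (-α₂ + α₄ p₂ / (μ - p₁))`. -/
def coeffD (a b : ZMod T → ℝ) (lam : ℂ) (θ : ℝ) (j : ℕ) : ℂ :=
  let μ : ℂ := Complex.exp (Complex.I * θ)
  let p₁ : ℂ := monodromy a b lam 0 0
  let p₂ : ℂ := monodromy a b lam 0 1
  let α : Matrix (Fin 2) (Fin 2) ℂ := transferProd a b lam (T - j) j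
  let α' : Matrix (Fin 2) (Fin 2) ℂ := transferProd a b lam 0 (T - j - 1)
  (‖μ - p₁‖ : ℂ) ^ 2 * μ / (2 * p₂)
    * (α' 1 0 * (p₂ / (μ - p₁)) + α' 1 1)
    * (-α 0 1 + α 1 1 * (p₂ / (μ - p₁)))

/-- `E_j(λ) = D_j(λ) / (2 T a_{T-j})`, for `0 ≤ j < T`. -/
def coeffE (a b : ZMod T → ℝ) (lam : ℂ) (θ : ℝ) (j : ℕ) : ℂ :=
  coeffD a b lam θ j / (2 * (T : ℂ) * (a ((T - j : ℕ) : ZMod T) : ℂ))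

/-- `E = ∑_{j=0}^{T-1} E_j(λ) e^{i((T-j)ω+φ)}`; it is `E(λ; k₊)` when `ω T + 2θ = 2π k₊`. -/
def resonanceCoeff (a b : ZMod T → ℝ) (lam : ℂ) (θ ω φ : ℝ) : ℂ :=
  ∑ j ∈ Finset.range T,
    coeffE a b lam θ j * Complex.exp (Complex.I * ((((T : ℝ) - j) * ω + φ : ℝ) : ℂ))

/-- The potential `q_1, q_2, …` with prescribed `q_1`, `q_2`, and `q_n = c sin(nω + φ) / n` for
`n ≥ 3`. -/
def potential (c ω φ q₁ q₂ : ℝ) (n : ℕ) : ℝ :=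
  if n = 1 then q₁ else if n = 2 then q₂ else c * Real.sin (n * ω + φ) / n

theorem bounded_potential (c ω φ q₁ q₂ : ℝ) :
    ∃ C, ∀ n : ℕ, |potential c ω φ q₁ q₂ (n + 1)| ≤ C := by
  refine ⟨|q₁| + |q₂| + |c|, fun n => ?_⟩
  have h1 := abs_nonneg q₁
  have h2 := abs_nonneg q₂
  have h3 := abs_nonneg c
  unfold potential
  split_ifs
  · linarith
  · linarith
  · have hn : (1 : ℝ) ≤ ((n + 1 : ℕ) : ℝ) := by
      exact_mod_cast Nat.succ_le_succ (Nat.zero_le n)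
    rw [abs_div, abs_mul, Nat.abs_cast]
    have hs := Real.abs_sin_le_one (((n + 1 : ℕ) : ℝ) * ω + φ)
    have : |c| * |Real.sin (((n + 1 : ℕ) : ℝ) * ω + φ)| / ((n + 1 : ℕ) : ℝ) ≤ |c| := by
      rw [div_le_iff₀ (by linarith)]
      nlinarith [abs_nonneg (Real.sin (((n + 1 : ℕ) : ℝ) * ω + φ))]
    linarith

/-- The diagonal operator `Q` on `ℓ²(ℕ)` with diagonal entries `q_1, q_2, q_3, …`. -/
def potentialOp (c ω φ q₁ q₂ : ℝ) : Module.End ℂ EllTwo :=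
  diagonalOp (fun n => potential c ω φ q₁ q₂ (n + 1)) (bounded_potential c ω φ q₁ q₂)

end

end JacobiWvN

/-!
The eigenvalue is produced by a resonance between the potential and the Floquet solutions at `λ`.

An elliptic `λ` is real (`conj_eq_of_monodromy_eigenvalue`), so real solutions `u` of the recurrence
suffice. Here `τ = p₂ / (μ - p₁)`, and `(-1, τ)` is a left eigenvector of `M(λ)` for `μ⁻¹`. The
complex amplitude `y_k = μ ^ k (-u_{kT} + τ u_{kT+1})` determines `u` on the `k`-th period, and would
be constant if there were no potential. Variation of constants over a period gives
`y_{k+1} - y_k = (α_k y_k + (β + γ_k) conj y_k) / k + O(|y_k| / k²)`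
(`amplitude_increment_approx`). Because `ωT = -2θ` modulo `2π`, the coefficients `α_k`, `γ_k` are
combinations of `μ ^ (±2k)` and `μ ^ (4k)`, which have bounded primitives since `θ` is neither a multiple
of `π` nor `π/2`, while `β` is `c` times a nonzero multiple of `E(λ; k₊)` (`exists_decaying_amplitude`,
`resonanceCoeff_eq`).

Averaging removes the oscillating terms, and a rotation leaves `w_{k+1} = w_k + (|β|/k) conj w_k` up to
`O(|w_k| / k²)` (`exists_decaying_of_oscillating`): the real part grows and the imaginary part decays.
For `|β| = 2`, an invariant cone and the compactness of the unit sphere of initial data give a nonzero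
solution with `w_k = O(1/k)` (`exists_decaying_of_conj_growth`). It is square summable, and the
free values `q₁`, `q₂` and `u₁` are used to satisfy the two equations at the boundary
(`exists_hasEigenvalue_of_tail`).
-/

namespace JacobiWvN

open ComplexConjugate Matrix

/-! ### Decaying solutions of asymptotically averaged recurrences -/

/-- The coordinates `re` and `im` of a solution of `w' ≈ w + (2/k) conj w` grow like
`k^2` and decay like `k^{-2}`. The cone `|im w| < |re w|` is forward invariant, so the initial data
whose trajectories avoid it up to time `k` form a decreasing sequence of nonempty compact sets, and a
trajectory that avoids it for ever decays. -/
theorem exists_decaying_of_conj_growth (w : ℕ → (ℝ × ℝ) →ₗ[ℝ] ℂ) (C : ℝ) (K : ℕ)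
    (h : ∀ k ≥ K, ∀ s, ‖w (k + 1) s - w k s - (2 / (k : ℂ)) * conj (w k s)‖
      ≤ C / (k : ℝ) ^ 2 * ‖w k s‖) :
    ∃ s : ℝ × ℝ, s ≠ 0 ∧ ∃ (C' : ℝ) (K' : ℕ), ∀ k ≥ K', ‖w k s‖ ≤ C' / k := by
  obtain ⟨N, hN⟩ := exists_nat_gt (2 * |C| + K + 4)
  have hNK : ∀ k ≥ N, K ≤ k := fun k hk => by
    have : (K : ℝ) ≤ N := by linarith [abs_nonneg C]
    exact (Nat.cast_le.1 this).trans hk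
  have hNC : ∀ k ≥ N, 2 * |C| + 4 < (k : ℝ) := fun k hk => by
    have : (N : ℝ) ≤ k := by exact_mod_cast hk
    have : (0 : ℝ) ≤ K := Nat.cast_nonneg _
    linarith
  -- the two scalar inequalities contained in the vector estimate
  have key : ∀ k ≥ N, ∀ s, ∀ r, |(w k s).re| ≤ r → |(w k s).im| ≤ r →
      |(w (k + 1) s).re - (1 + 2 / (k : ℝ)) * (w k s).re| ≤ 1 / (k : ℝ) * r ∧
      |(w (k + 1) s).im - (1 - 2 / (k : ℝ)) * (w k s).im| ≤ 1 / (k : ℝ) * r := by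
    intro k hk s r hr hi
    have hk0 : 0 < (k : ℝ) := by linarith [hNC k hk, abs_nonneg C]
    have hr0 : 0 ≤ r := (abs_nonneg _).trans hr
    have hb : C / (k : ℝ) ^ 2 * ‖w k s‖ ≤ 1 / (k : ℝ) * r := by
      have h1 : ‖w k s‖ ≤ 2 * r := (Complex.norm_le_abs_re_add_abs_im _).trans (by linarith)
      calc C / (k : ℝ) ^ 2 * ‖w k s‖ ≤ |C| / (k : ℝ) ^ 2 * (2 * r) := by
            gcongr; exact le_abs_self C
        _ = (2 * |C| / k) * (1 / k * r) := by field_simp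
        _ ≤ 1 * (1 / k * r) := by
            gcongr
            rw [div_le_one hk0]; linarith [hNC k hk]
        _ = _ := one_mul _
    have h2 := (h k (hNK k hk) s).trans hb
    have e : (2 / (k : ℂ)) = ((2 / (k : ℝ) : ℝ) : ℂ) := by push_cast; rfl
    rw [e] at h2
    constructor
    · refine le_trans (le_of_eq ?_) ((Complex.abs_re_le_norm _).trans h2)
      congr 1
      simp; ring
    · refine le_trans (le_of_eq ?_) ((Complex.abs_im_le_norm _).trans h2)
      congr 1
      simp; ring
  have step : ∀ k ≥ N, ∀ s, |(w k s).im| < |(w k s).re| →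
      |(w (k + 1) s).im| < |(w (k + 1) s).re| := by
    intro k hk s hs
    obtain ⟨h1, h2⟩ := key k hk s _ le_rfl hs.le
    have hk4 : 4 < (k : ℝ) := by linarith [hNC k hk, abs_nonneg C]
    have hk0 : 0 < (k : ℝ) := by linarith
    have hr0 : 0 < |(w k s).re| := (abs_nonneg _).trans_lt hs
    have hi0 := abs_nonneg (w k s).im
    have hd : 0 < 1 / (k : ℝ) := by positivity
    have hd2 : 2 / (k : ℝ) = 2 * (1 / k) := by ring
    have hd3 : 1 / (k : ℝ) < 1 / 4 := one_div_lt_one_div_of_lt (by norm_num) hk4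
    have h3 := abs_sub_abs_le_abs_sub ((1 + 2 / (k : ℝ)) * (w k s).re) ((w (k + 1) s).re)
    have h4 := abs_sub_abs_le_abs_sub ((w (k + 1) s).im) ((1 - 2 / (k : ℝ)) * (w k s).im)
    rw [abs_sub_comm] at h1
    rw [abs_mul, abs_of_pos (show 0 < 1 + 2 / (k : ℝ) by positivity)] at h3
    rw [abs_mul, abs_of_pos (show 0 < 1 - 2 / (k : ℝ) by linarith)] at h4
    rw [hd2] at h1 h2 h3 h4
    have h5 : (1 - 2 * (1 / (k : ℝ))) * |(w k s).im| ≤ (1 - 2 * (1 / (k : ℝ))) * |(w k s).re| :=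
      mul_le_mul_of_nonneg_left hs.le (by linarith)
    nlinarith [mul_pos hd hr0]
  have decay : ∀ k ≥ N, ∀ s, |(w k s).re| ≤ |(w k s).im| →
      |(w (k + 1) s).im| * k ≤ |(w k s).im| * ((k : ℝ) - 1) := by
    intro k hk s hs
    obtain ⟨-, h2⟩ := key k hk s _ hs le_rfl
    have hk4 : 4 < (k : ℝ) := by linarith [hNC k hk, abs_nonneg C]
    have hk0 : 0 < (k : ℝ) := by linarith
    have hd3 : 1 / (k : ℝ) < 1 / 4 := one_div_lt_one_div_of_lt (by norm_num) hk4
    have h4 := abs_sub_abs_le_abs_sub ((w (k + 1) s).im) ((1 - 2 / (k : ℝ)) * (w k s).im)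
    have hd2 : 2 / (k : ℝ) = 2 * (1 / k) := by ring
    rw [abs_mul, abs_of_pos (show 0 < 1 - 2 / (k : ℝ) by linarith)] at h4
    have h5 : |(w (k + 1) s).im| ≤ (1 - 1 / (k : ℝ)) * |(w k s).im| := by
      rw [hd2] at h2 h4; linarith
    calc |(w (k + 1) s).im| * k ≤ (1 - 1 / (k : ℝ)) * |(w k s).im| * k := by gcongr
      _ = _ := by field_simp
  let S : ℕ → Set (ℝ × ℝ) := fun n =>
    {s | s ∈ Metric.sphere (0 : ℝ × ℝ) 1 ∧ |(w (N + n) s).re| ≤ |(w (N + n) s).im|}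
  have hcont : ∀ n, Continuous (w n) := fun n => (w n).continuous_of_finiteDimensional
  have hclosed : ∀ n, IsClosed (S n) := fun n => by
    refine IsClosed.and Metric.isClosed_sphere (isClosed_le ?_ ?_)
    · exact (Complex.continuous_re.comp (hcont _)).abs
    · exact (Complex.continuous_im.comp (hcont _)).abs
  have hne : (⋂ n, S n).Nonempty := by
    refine IsCompact.nonempty_iInter_of_sequence_nonempty_isCompact_isClosed S ?_ ?_ ?_ hclosed
    · rintro n s ⟨hs, hs'⟩
      refine ⟨hs, ?_⟩
      by_contra hlt
      have := step (N + n) (by omega) s (not_le.1 hlt)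
      exact absurd hs' (not_le.2 this)
    · intro n
      let f : (ℝ × ℝ) →ₗ[ℝ] ℝ := Complex.reLm ∘ₗ w (N + n)
      have hf : LinearMap.ker f ≠ ⊥ := LinearMap.ker_ne_bot_of_finrank_lt (by simp)
      obtain ⟨s, hs, hs0⟩ := (Submodule.ne_bot_iff _).1 hf
      have hs' : (w (N + n) s).re = 0 := hs
      refine ⟨‖s‖⁻¹ • s, ?_, ?_⟩
      · simp [norm_smul, norm_ne_zero_iff.2 hs0]
      · simp only [map_smul, Complex.real_smul, Complex.re_ofReal_mul, hs', mul_zero, abs_zero]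
        exact abs_nonneg _
    · exact (isCompact_sphere _ _).of_isClosed_subset (hclosed 0) fun s hs => hs.1
  obtain ⟨s, hs⟩ := hne
  rw [Set.mem_iInter] at hs
  have hcone : ∀ k ≥ N, |(w k s).re| ≤ |(w k s).im| := fun k hk => by
    obtain ⟨n, rfl⟩ := Nat.exists_eq_add_of_le hk
    exact (hs n).2
  have hs0 : s ≠ 0 := by
    rintro rfl
    simpa using (hs 0).1
  have hN4 : 4 < (N : ℝ) := by linarith [hNC N le_rfl, abs_nonneg C]
  have hmono : ∀ n, |(w (N + n) s).im| * (((N + n : ℕ) : ℝ) - 1) ≤ |(w N s).im| * ((N : ℝ) - 1) := by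
    intro n
    induction n with
    | zero => simp
    | succ n ih =>
      refine le_trans ?_ ih
      have := decay (N + n) (by omega) s (hcone _ (by omega))
      rw [← add_assoc]
      push_cast at this ⊢
      linarith
  refine ⟨s, hs0, 4 * (|(w N s).im| * ((N : ℝ) - 1)), N, fun k hk => ?_⟩
  obtain ⟨n, rfl⟩ := Nat.exists_eq_add_of_le hk
  have hk4 : 4 < ((N + n : ℕ) : ℝ) := by linarith [hNC (N + n) hk, abs_nonneg C]
  rw [le_div_iff₀ (by linarith)]
  have h1 := (Complex.norm_le_abs_re_add_abs_im (w (N + n) s)).trans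
    (add_le_add (hcone _ hk) le_rfl)
  have h2 := hmono n
  nlinarith [norm_nonneg (w (N + n) s), abs_nonneg (w (N + n) s).im]

/-- Averaging. Oscillating terms of size `1/k` whose coefficients have bounded primitives `A`, `G` are
removed by the substitution `z_k = x_k - (A_k x_k + G_k conj x_k) / k`, at the price of an error
of order `k^{-2}`; a rotation then makes the remaining coefficient positive. -/
theorem exists_decaying_of_oscillating (x : ℕ → (ℝ × ℝ) →ₗ[ℝ] ℂ) (β : ℂ) (hβ : ‖β‖ = 2)
    (A G : ℕ → ℂ) (R : ℝ) (hA : ∀ k, ‖A k‖ ≤ R) (hG : ∀ k, ‖G k‖ ≤ R) (C : ℝ)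
    (h : ∀ k ≥ 1, ∀ s, ‖x (k + 1) s - x k s - (1 / (k : ℂ)) *
        ((A (k + 1) - A k) * x k s + (β + (G (k + 1) - G k)) * conj (x k s))‖
      ≤ C / (k : ℝ) ^ 2 * ‖x k s‖) :
    ∃ s : ℝ × ℝ, s ≠ 0 ∧ ∃ (C' : ℝ) (K' : ℕ), ∀ k ≥ K', ‖x k s‖ ≤ C' / k := by
  have hR : 0 ≤ R := (norm_nonneg _).trans (hA 0)
  obtain ⟨e, he⟩ : ∃ e : ℂ, e ^ 2 = β / 2 := IsAlgClosed.exists_pow_nat_eq _ (by norm_num)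
  have hen : ‖e‖ = 1 := by
    have : ‖e‖ ^ 2 = 1 := by rw [← norm_pow, he, norm_div, hβ]; norm_num
    exact (pow_eq_one_iff_of_nonneg (norm_nonneg _) two_ne_zero).1 this
  have hee : e * conj e = 1 := by rw [Complex.mul_conj, Complex.normSq_eq_norm_sq, hen]; norm_num
  have hP : ∀ k j v, ‖A k * v + G j * conj v‖ ≤ 2 * R * ‖v‖ := fun k j v => by
    refine (norm_add_le _ _).trans ?_
    rw [norm_mul, norm_mul, RCLike.norm_conj]
    nlinarith [mul_le_mul_of_nonneg_right (hA k) (norm_nonneg v),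
      mul_le_mul_of_nonneg_right (hG j) (norm_nonneg v)]
  let w : ℕ → (ℝ × ℝ) →ₗ[ℝ] ℂ := fun k =>
    { toFun := fun s => conj e * (x k s - (1 / (k : ℂ)) * (A k * x k s + G k * conj (x k s)))
      map_add' := fun s t => by simp only [map_add]; ring
      map_smul' := fun r s => by
        simp only [map_smul, Complex.real_smul, map_mul, Complex.conj_ofReal, RingHom.id_apply]
        ring }
  have hw : ∀ k s, w k s =
      conj e * (x k s - (1 / (k : ℂ)) * (A k * x k s + G k * conj (x k s))) := fun _ _ => rfl
  have hcn : ‖conj e‖ = 1 := by rw [RCLike.norm_conj, hen]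
  obtain ⟨K, hK⟩ := exists_nat_gt (4 * R + 1)
  have hxw : ∀ k ≥ K, ∀ s, ‖x k s‖ ≤ 2 * ‖w k s‖ := by
    intro k hk s
    have hk' : 4 * R + 1 < (k : ℝ) := hK.trans_le (by exact_mod_cast hk)
    have hk0 : (0 : ℝ) < k := by linarith
    rw [hw, norm_mul, hcn, one_mul]
    have h1 := norm_sub_norm_le (x k s) ((1 / (k : ℂ)) * (A k * x k s + G k * conj (x k s)))
    have h2 : ‖(1 / (k : ℂ)) * (A k * x k s + G k * conj (x k s))‖ ≤ 1 / 2 * ‖x k s‖ := by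
      rw [norm_mul, norm_div, norm_one, Complex.norm_natCast]
      calc 1 / (k : ℝ) * ‖A k * x k s + G k * conj (x k s)‖ ≤ 1 / k * (2 * R * ‖x k s‖) := by
            gcongr; exact hP k k _
        _ = (2 * R / k) * ‖x k s‖ := by ring
        _ ≤ 1 / 2 * ‖x k s‖ := by
            refine mul_le_mul_of_nonneg_right ?_ (norm_nonneg _)
            rw [div_le_iff₀ hk0]; linarith
    linarith
  let D : ℝ := |C| + 2 * R * (4 * R + 2 + |C|) + 2 * R + 4 * R
  have hD : 0 ≤ D := by positivity
  obtain ⟨s, hs0, C', K', hs⟩ := exists_decaying_of_conj_growth w (D * 2) (K + 1) (by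
    intro k hk s
    have hk1 : (1 : ℝ) ≤ k := by exact_mod_cast (show 1 ≤ k by omega)
    have hk0 : (0 : ℝ) < k := by linarith
    have hkC : (k : ℂ) ≠ 0 := by exact_mod_cast hk0.ne'
    have hkC1 : (k : ℂ) + 1 ≠ 0 := by exact_mod_cast (by linarith : (k : ℝ) + 1 ≠ 0)
    set v := x k s with hv
    set v' := x (k + 1) s with hv'
    set err := v' - v - (1 / (k : ℂ)) *
        ((A (k + 1) - A k) * v + (β + (G (k + 1) - G k)) * conj v) with herr
    have herrb : ‖err‖ ≤ |C| / (k : ℝ) ^ 2 * ‖v‖ :=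
      (h k (by omega) s).trans (by gcongr; exact le_abs_self C)
    have hdiff : ‖v' - v‖ ≤ (4 * R + 2 + |C|) / k * ‖v‖ := by
      have e1 : v' - v = err + (1 / (k : ℂ)) *
        ((A (k + 1) * v + G (k + 1) * conj v) - (A k * v + G k * conj v) + β * conj v) := by
        rw [herr]; ring
      have e2 : ‖(A (k + 1) * v + G (k + 1) * conj v) - (A k * v + G k * conj v) + β * conj v‖
          ≤ (4 * R + 2) * ‖v‖ := by
        refine (norm_add_le _ _).trans ?_
        have := (norm_sub_le (A (k + 1) * v + G (k + 1) * conj v) (A k * v + G k * conj v)).trans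
          (add_le_add (hP _ _ v) (hP _ _ v))
        rw [norm_mul, hβ, RCLike.norm_conj]
        linarith
      have e3 : |C| / (k : ℝ) ^ 2 ≤ |C| / k := by
        gcongr; nlinarith
      rw [e1]
      refine (norm_add_le _ _).trans ?_
      rw [norm_mul, norm_div, norm_one, Complex.norm_natCast]
      calc _ ≤ |C| / k * ‖v‖ + 1 / k * ((4 * R + 2) * ‖v‖) := by
            gcongr
            exact herrb.trans (by gcongr)
        _ = _ := by ring
    have ident : w (k + 1) s - w k s - (2 / (k : ℂ)) * conj (w k s)
        = conj e * (err - (1 / ((k : ℂ) + 1)) *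
            (A (k + 1) * (v' - v) + G (k + 1) * conj (v' - v))
          + (1 / ((k : ℂ) * (k + 1))) * (A (k + 1) * v + G (k + 1) * conj v)
          + (1 / (k : ℂ) ^ 2) * (β * conj (A k * v + G k * conj v))) := by
      rw [hw, hw, ← hv, ← hv', herr]
      have hβe : β = 2 * e ^ 2 := by rw [he]; ring
      have hrot : 2 * conj (conj e) = conj e * β := by
        rw [hβe, Complex.conj_conj]; linear_combination (-2 * e) * hee
      have hconjk : conj (1 / (k : ℂ)) = 1 / k := by simp
      simp only [map_mul, map_sub, map_add, hconjk, Complex.conj_conj] at hrot ⊢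
      push_cast
      field_simp
      linear_combination (-(k + 1) * (k * conj v - conj (A k) * conj v - conj (G k) * v)) * hrot
    rw [ident, norm_mul, hcn, one_mul]
    have b1 : ‖(1 / ((k : ℂ) + 1)) * (A (k + 1) * (v' - v) + G (k + 1) * conj (v' - v))‖
        ≤ 2 * R * (4 * R + 2 + |C|) / (k : ℝ) ^ 2 * ‖v‖ := by
      have : ‖1 / ((k : ℂ) + 1)‖ ≤ 1 / k := by
        rw [norm_div, norm_one, show (k : ℂ) + 1 = ((k + 1 : ℕ) : ℂ) by push_cast; rfl,
          Complex.norm_natCast]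
        gcongr; simp
      rw [norm_mul]
      calc _ ≤ 1 / (k : ℝ) * (2 * R * ((4 * R + 2 + |C|) / k * ‖v‖)) := by
            gcongr
            exact (hP _ _ _).trans (by gcongr)
        _ = _ := by field_simp
    have b2 : ‖(1 / ((k : ℂ) * (k + 1))) * (A (k + 1) * v + G (k + 1) * conj v)‖
        ≤ 2 * R / (k : ℝ) ^ 2 * ‖v‖ := by
      have : ‖1 / ((k : ℂ) * (k + 1))‖ ≤ 1 / (k : ℝ) ^ 2 := by
        rw [norm_div, norm_one, norm_mul, show (k : ℂ) + 1 = ((k + 1 : ℕ) : ℂ) by push_cast; rfl,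
          Complex.norm_natCast, Complex.norm_natCast, sq]
        gcongr; simp
      rw [norm_mul]
      calc _ ≤ 1 / (k : ℝ) ^ 2 * (2 * R * ‖v‖) := by
            gcongr
            exact hP _ _ _
        _ = _ := by field_simp
    have b3 : ‖(1 / (k : ℂ) ^ 2) * (β * conj (A k * v + G k * conj v))‖
        ≤ 4 * R / (k : ℝ) ^ 2 * ‖v‖ := by
      rw [norm_mul, norm_div, norm_one, norm_pow, Complex.norm_natCast, norm_mul, hβ,
        RCLike.norm_conj]
      calc _ ≤ 1 / (k : ℝ) ^ 2 * (2 * (2 * R * ‖v‖)) := by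
            gcongr
            exact hP _ _ _
        _ = _ := by ring
    calc _ ≤ |C| / (k : ℝ) ^ 2 * ‖v‖ + 2 * R * (4 * R + 2 + |C|) / (k : ℝ) ^ 2 * ‖v‖
          + 2 * R / (k : ℝ) ^ 2 * ‖v‖ + 4 * R / (k : ℝ) ^ 2 * ‖v‖ := by
          refine (norm_add_le _ _).trans (add_le_add ((norm_add_le _ _).trans (add_le_add
            ((norm_sub_le _ _).trans (add_le_add herrb b1)) b2)) b3)
      _ = D / (k : ℝ) ^ 2 * ‖v‖ := by simp only [D]; ring
      _ ≤ D / (k : ℝ) ^ 2 * (2 * ‖w k s‖) := by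
          gcongr
          exact hxw k (by omega) s
      _ = _ := by ring)
  refine ⟨s, hs0, 2 * C', K' + K, fun k hk => (hxw k (by omega) s).trans ?_⟩
  rw [mul_div_assoc]
  exact mul_le_mul_of_nonneg_left (hs k (by omega)) zero_le_two

/-! ### Transfer matrices and perturbed solutions -/

variable {T : ℕ}

theorem transferMatrix_mulVec (a b : ZMod T → ℝ) (lam : ℂ) (m : ℕ) (x y : ℂ) :
    transferMatrix a b lam (m + 1) *ᵥ ![x, y] =
      ![y, ((lam - b ((m + 1 : ℕ) : ZMod T)) * y - a (m : ZMod T) * x)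
        / a ((m + 1 : ℕ) : ZMod T)] := by
  have h : ((m + 1 : ℕ) : ZMod T) - 1 = (m : ZMod T) := by push_cast; ring
  ext i
  fin_cases i
  · simp [transferMatrix, mulVec, dotProduct, Fin.sum_univ_two]
  · simp only [transferMatrix, h, mulVec, dotProduct, Fin.sum_univ_two]
    simp
    ring

/-- Variation of constants for transfer matrices. -/
theorem transferProd_variation (a b : ZMod T → ℝ) (lam : ℂ) (u r : ℕ → ℂ)
    (h : ∀ m, ![u (m + 1), u (m + 2)] =
      transferMatrix a b lam (m + 1) *ᵥ ![u m, u (m + 1)] - r m • ![0, 1]) (n : ℕ) :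
    ![u n, u (n + 1)] = transferProd a b lam 0 n *ᵥ ![u 0, u 1]
      - ∑ m ∈ Finset.range n, r m • (transferProd a b lam (m + 1) (n - 1 - m) *ᵥ ![0, 1]) := by
  induction n with
  | zero => simp [transferProd]
  | succ n ih =>
    rw [h n, ih, Finset.sum_range_succ, mulVec_sub, mulVec_mulVec, mulVec_sum, ← sub_sub]
    congr 1
    · congr 1
      · simp [transferProd]
      · refine Finset.sum_congr rfl fun m hm => ?_
        have hm' := Finset.mem_range.1 hm
        rw [mulVec_smul, mulVec_mulVec, show n + 1 - 1 - m = (n - 1 - m) + 1 by omega,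
          transferProd, show m + 1 + (n - 1 - m) + 1 = n + 1 by omega]
    · simp [transferProd]

/-- At an energy where the monodromy matrix has an eigenvalue of modulus one, Green's identity for the
corresponding Floquet solution over one period shows that the energy is real. -/
theorem conj_eq_of_monodromy_eigenvalue [NeZero T] (a b : ZMod T → ℝ) (ha : ∀ i, 0 < a i) (lam μ : ℂ)
    (hμ : ‖μ‖ = 1)
    (h : Module.End.HasEigenvalue (Matrix.toLin' (monodromy a b lam)) μ) : conj lam = lam := by
  obtain ⟨v, hv⟩ := h.exists_hasEigenvector
  have hMv : monodromy a b lam *ᵥ v = μ • v := by simpa using hv.apply_eq_smul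
  let u : ℕ → ℂ := fun n => (transferProd a b lam 0 n *ᵥ v) 0
  have hstep : ∀ n, transferProd a b lam 0 (n + 1) *ᵥ v =
      transferMatrix a b lam (n + 1) *ᵥ (transferProd a b lam 0 n *ᵥ v) := fun n => by
    rw [mulVec_mulVec, transferProd, zero_add]
  have hu : ∀ n, transferProd a b lam 0 n *ᵥ v = ![u n, u (n + 1)] := by
    intro n
    ext i
    fin_cases i
    · rfl
    · simp only [u, hstep]
      simp [transferMatrix, mulVec, dotProduct, Fin.sum_univ_two]
  have hrec : ∀ n : ℕ, (a ((n + 1 : ℕ) : ZMod T) : ℂ) * u (n + 2) =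
      (lam - b ((n + 1 : ℕ) : ZMod T)) * u (n + 1) - a (n : ZMod T) * u n := by
    intro n
    have h1 := hstep n
    rw [hu, hu, transferMatrix_mulVec] at h1
    have h2 := congrFun h1 1
    simp only [cons_val_one, cons_val_fin_one] at h2
    have h3 : (a ((n + 1 : ℕ) : ZMod T) : ℂ) ≠ 0 := by exact_mod_cast (ha _).ne'
    rw [h2, mul_div_cancel₀ _ h3]
  let W : ℕ → ℂ := fun n => a (n : ZMod T) * (u (n + 1) * conj (u n) - u n * conj (u (n + 1)))
  have hW : ∀ n, W (n + 1) - W n = (lam - conj lam) * (‖u (n + 1)‖ ^ 2 : ℝ) := by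
    intro n
    have h1 := hrec n
    have h2 := congrArg conj h1
    simp only [map_mul, map_sub, Complex.conj_ofReal] at h2
    have h3 : ((‖u (n + 1)‖ ^ 2 : ℝ) : ℂ) = u (n + 1) * conj (u (n + 1)) := by
      rw [Complex.mul_conj, Complex.normSq_eq_norm_sq]
    simp only [W, h3]
    linear_combination conj (u (n + 1)) * h1 - u (n + 1) * h2
  have hT := hu T
  rw [show transferProd a b lam 0 T = monodromy a b lam from rfl, hMv] at hT
  have h0 := hu 0
  simp only [transferProd, one_mulVec] at h0
  have hv0 : v 0 = u 0 := by rw [h0]; rfl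
  have hv1 : v 1 = u 1 := by rw [h0]; rfl
  have hT0 : u T = μ * u 0 := by
    have := congrFun hT 0
    simp only [Pi.smul_apply, smul_eq_mul, cons_val_zero] at this
    rw [← this, hv0]
  have hT1 : u (T + 1) = μ * u 1 := by
    have := congrFun hT 1
    simp only [Pi.smul_apply, smul_eq_mul, cons_val_one, cons_val_fin_one] at this
    rw [← this, hv1]
  have hμc : μ * conj μ = 1 := by
    rw [Complex.mul_conj, Complex.normSq_eq_norm_sq, hμ]; norm_num
  have hWT : W T = W 0 := by
    simp only [W, hT0, hT1, CharP.cast_eq_zero, Nat.cast_zero, map_mul, zero_add]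
    linear_combination (a 0 * (u 1 * conj (u 0) - u 0 * conj (u 1))) * hμc
  have hsum : (lam - conj lam) * ((∑ n ∈ Finset.range T, ‖u (n + 1)‖ ^ 2 : ℝ) : ℂ) = 0 := by
    rw [Complex.ofReal_sum, Finset.mul_sum, ← Finset.sum_congr rfl fun n _ => hW n,
      Finset.sum_range_sub, hWT, sub_self]
  rcases mul_eq_zero.1 hsum with h1 | h1
  · exact (sub_eq_zero.1 h1).symm
  · exfalso
    have h2 : ∑ n ∈ Finset.range T, ‖u (n + 1)‖ ^ 2 = 0 := by exact_mod_cast h1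
    rw [Finset.sum_eq_zero_iff_of_nonneg fun _ _ => by positivity] at h2
    have hT' := NeZero.pos T
    have h3 : u 1 = 0 := by simpa using h2 0 (Finset.mem_range.2 hT')
    have h4 : u T = 0 := by
      have := h2 (T - 1) (Finset.mem_range.2 (by omega))
      rw [Nat.sub_add_cancel hT'] at this
      simpa using this
    have hμ0 : μ ≠ 0 := by rintro rfl; simp at hμ
    have h5 : u 0 = 0 := by
      rw [hT0] at h4
      exact (mul_eq_zero.1 h4).resolve_left hμ0
    apply hv.2
    ext i
    fin_cases i
    · simpa [hv0] using h5
    · simpa [hv1] using h3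

theorem conj_transferProd (a b : ZMod T → ℝ) (l : ℝ) (s m : ℕ) (i j : Fin 2) :
    conj (transferProd a b (l : ℂ) s m i j) = transferProd a b (l : ℂ) s m i j := by
  induction m generalizing i j with
  | zero => fin_cases i <;> fin_cases j <;> simp [transferProd]
  | succ m ih =>
    rw [transferProd, mul_apply, map_sum]
    refine Finset.sum_congr rfl fun x _ => ?_
    rw [map_mul, ih]
    congr 1
    fin_cases i <;> fin_cases x <;> simp [transferMatrix]

theorem det_sub_smul_eq_zero_of_hasEigenvalue (M : Matrix (Fin 2) (Fin 2) ℂ) (μ : ℂ)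
    (h : Module.End.HasEigenvalue (Matrix.toLin' M) μ) :
    (M 0 0 - μ) * (M 1 1 - μ) - M 0 1 * M 1 0 = 0 := by
  obtain ⟨v, hv⟩ := h.exists_hasEigenvector
  have hMv : M *ᵥ v = μ • v := by simpa using hv.apply_eq_smul
  have h1 : (M - μ • (1 : Matrix (Fin 2) (Fin 2) ℂ)).det = 0 := by
    refine exists_mulVec_eq_zero_iff.1 ⟨v, hv.2, ?_⟩
    rw [sub_mulVec, hMv, smul_mulVec, one_mulVec, sub_self]
  rw [det_fin_two] at h1
  simpa using h1

/-- The solution, at energy `l`, of the periodic Jacobi recurrence perturbed by the potential `q`, as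
a linear function of its initial data `(u₀, u₁)`. The recurrence holds at every index `n ≥ 1`; there is
no boundary condition. -/
noncomputable def perturbedSol (a b : ZMod T → ℝ) (l : ℝ) (q : ℕ → ℝ) : ℕ → (ℝ × ℝ) →ₗ[ℝ] ℝ
  | 0 => LinearMap.fst ℝ ℝ ℝ
  | 1 => LinearMap.snd ℝ ℝ ℝ
  | n + 2 => (a ((n + 1 : ℕ) : ZMod T))⁻¹ • ((l - b ((n + 1 : ℕ) : ZMod T) - q (n + 1)) •
      perturbedSol a b l q (n + 1) - a (n : ZMod T) • perturbedSol a b l q n)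

theorem perturbedSol_rec (a b : ZMod T → ℝ) (ha : ∀ i, 0 < a i) (l : ℝ) (q : ℕ → ℝ) (n : ℕ)
    (s : ℝ × ℝ) :
    a (n : ZMod T) * perturbedSol a b l q n s
      + (b ((n + 1 : ℕ) : ZMod T) + q (n + 1)) * perturbedSol a b l q (n + 1) s
      + a ((n + 1 : ℕ) : ZMod T) * perturbedSol a b l q (n + 2) s
      = l * perturbedSol a b l q (n + 1) s := by
  rw [perturbedSol]
  simp only [LinearMap.smul_apply, LinearMap.sub_apply, smul_eq_mul]
  rw [mul_inv_cancel_left₀ (ha _).ne']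
  ring

/-- Two consecutive zeros force a solution to vanish. -/
theorem perturbedSol_injective (a b : ZMod T → ℝ) (ha : ∀ i, 0 < a i) (l : ℝ) (q : ℕ → ℝ) (n : ℕ)
    (s : ℝ × ℝ) (h0 : perturbedSol a b l q n s = 0) (h1 : perturbedSol a b l q (n + 1) s = 0) :
    s = 0 := by
  induction n with
  | zero => exact Prod.ext h0 h1
  | succ n ih =>
    refine ih ?_ h0
    have := perturbedSol_rec a b ha l q n s
    rw [h0, h1] at this
    simpa [(ha _).ne'] using this

/-- Solutions grow at most exponentially, uniformly in the starting point. -/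
theorem perturbedSol_growth [NeZero T] (a b : ZMod T → ℝ) (l : ℝ) (q : ℕ → ℝ) (Q : ℝ)
    (hq : ∀ n, |q n| ≤ Q) :
    ∃ C : ℝ, 1 ≤ C ∧ ∀ n m s, |perturbedSol a b l q (n + m) s| ≤
      C ^ m * (|perturbedSol a b l q n s| + |perturbedSol a b l q (n + 1) s|) := by
  obtain ⟨A, hA⟩ := bounded_periodic a fun n => (n : ZMod T)
  obtain ⟨B, hB⟩ := bounded_periodic b fun n => (n : ZMod T)
  obtain ⟨I, hI⟩ := bounded_periodic (fun i => (a i)⁻¹) fun n => (n : ZMod T)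
  have hA0 : 0 ≤ A := (abs_nonneg _).trans (hA 0)
  have hB0 : 0 ≤ B := (abs_nonneg _).trans (hB 0)
  have hI0 : 0 ≤ I := (abs_nonneg _).trans (hI 0)
  have hQ0 : 0 ≤ Q := (abs_nonneg _).trans (hq 0)
  let L : ℝ := I * (|l| + B + Q + A)
  have hL : 0 ≤ L := by positivity
  have hstep : ∀ n s, |perturbedSol a b l q (n + 1) s| + |perturbedSol a b l q (n + 2) s| ≤
      (1 + L) * (|perturbedSol a b l q n s| + |perturbedSol a b l q (n + 1) s|) := by
    intro n s
    have h0 := abs_nonneg (perturbedSol a b l q n s)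
    have h1 := abs_nonneg (perturbedSol a b l q (n + 1) s)
    have h2 : |perturbedSol a b l q (n + 2) s| ≤
        L * (|perturbedSol a b l q n s| + |perturbedSol a b l q (n + 1) s|) := by
      rw [perturbedSol]
      simp only [LinearMap.smul_apply, LinearMap.sub_apply, smul_eq_mul]
      rw [abs_mul]
      have h3 : |l - b ((n + 1 : ℕ) : ZMod T) - q (n + 1)| ≤ |l| + B + Q :=
        (abs_sub _ _).trans (add_le_add ((abs_sub _ _).trans (add_le_add le_rfl (hB _))) (hq _))
      have h4 := abs_sub ((l - b ((n + 1 : ℕ) : ZMod T) - q (n + 1)) *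
        perturbedSol a b l q (n + 1) s) (a (n : ZMod T) * perturbedSol a b l q n s)
      rw [abs_mul, abs_mul] at h4
      have h5 : |(l - b ((n + 1 : ℕ) : ZMod T) - q (n + 1)) *
        perturbedSol a b l q (n + 1) s - a (n : ZMod T) * perturbedSol a b l q n s| ≤
          (|l| + B + Q + A) * (|perturbedSol a b l q n s| + |perturbedSol a b l q (n + 1) s|) := by
        have h6 := mul_le_mul_of_nonneg_right h3 h1
        have h7 := mul_le_mul_of_nonneg_right (hA n) h0
        have h8 : 0 ≤ (|l| + B + Q) * |perturbedSol a b l q n s| := by positivity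
        have h9 := mul_nonneg hA0 h1
        linarith
      calc _ ≤ I * ((|l| + B + Q + A) *
              (|perturbedSol a b l q n s| + |perturbedSol a b l q (n + 1) s|)) := by
            gcongr
            exact hI _
        _ = _ := by ring
    linarith
  refine ⟨1 + L, by linarith, fun n m s => ?_⟩
  have hind : |perturbedSol a b l q (n + m) s| + |perturbedSol a b l q (n + m + 1) s| ≤
      (1 + L) ^ m * (|perturbedSol a b l q n s| + |perturbedSol a b l q (n + 1) s|) := by
    induction m with
    | zero => simp
    | succ m ih =>
      refine (hstep (n + m) s).trans ?_
      rw [pow_succ', mul_assoc]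
      exact mul_le_mul_of_nonneg_left ih (by linarith)
  linarith [abs_nonneg (perturbedSol a b l q (n + m + 1) s)]

/-! ### The amplitude of a solution -/

/-- The complex amplitude at the end of `k` periods: the left eigenvector `(-1, τ)` of the monodromy
matrix, for the eigenvalue `μ⁻¹`, applied to `(u_{kT}, u_{kT+1})` and multiplied by `μ ^ k`, so that it
is constant in `k` for a solution of the unperturbed recurrence. -/
noncomputable def amplitude (a b : ZMod T → ℝ) (l : ℝ) (q : ℕ → ℝ) (μ τ : ℂ) (k : ℕ) :
    (ℝ × ℝ) →ₗ[ℝ] ℂ where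
  toFun s := μ ^ k * (-(perturbedSol a b l q (k * T) s : ℂ)
    + τ * (perturbedSol a b l q (k * T + 1) s : ℂ))
  map_add' s t := by simp only [map_add]; push_cast; ring
  map_smul' r s := by
    simp only [map_smul, smul_eq_mul, Complex.ofReal_mul, Complex.real_smul, RingHom.id_apply]
    ring

theorem amplitude_apply (a b : ZMod T → ℝ) (l : ℝ) (q : ℕ → ℝ) (μ τ : ℂ) (k : ℕ) (s : ℝ × ℝ) :
    amplitude a b l q μ τ k s = μ ^ k * (-(perturbedSol a b l q (k * T) s : ℂ)
      + τ * (perturbedSol a b l q (k * T + 1) s : ℂ)) := rfl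

theorem perturbedSol_eq_amplitude (a b : ZMod T → ℝ) (l : ℝ) (q : ℕ → ℝ) (μ τ : ℂ)
    (hμ : μ * conj μ = 1) (hτ : τ - conj τ ≠ 0) (k : ℕ) (s : ℝ × ℝ) :
    (perturbedSol a b l q (k * T) s : ℂ) =
      (conj μ ^ k * amplitude a b l q μ τ k s * conj τ
        - μ ^ k * conj (amplitude a b l q μ τ k s) * τ) / (τ - conj τ) ∧
    (perturbedSol a b l q (k * T + 1) s : ℂ) =
      (conj μ ^ k * amplitude a b l q μ τ k s
        - μ ^ k * conj (amplitude a b l q μ τ k s)) / (τ - conj τ) := by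
  have hk : μ ^ k * conj μ ^ k = 1 := by rw [← mul_pow, hμ, one_pow]
  simp only [amplitude_apply, map_mul, map_pow, map_add, map_neg, Complex.conj_ofReal]
  constructor
  · rw [eq_div_iff hτ]
    linear_combination ((perturbedSol a b l q (k * T) s : ℂ) * (conj τ - τ)) * hk
  · rw [eq_div_iff hτ]
    linear_combination ((perturbedSol a b l q (k * T + 1) s : ℂ) * (conj τ - τ)) * hk

/-- The solution on the whole `k`-th period is controlled by the amplitude at its beginning. -/
theorem perturbedSol_le_amplitude [NeZero T] (a b : ZMod T → ℝ) (l : ℝ) (q : ℕ → ℝ) (Q : ℝ)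
    (hq : ∀ n, |q n| ≤ Q) (μ τ : ℂ) (hμ : μ * conj μ = 1) (hτ : τ - conj τ ≠ 0) :
    ∃ C : ℝ, 0 ≤ C ∧ ∀ k s, ∀ m ≤ T, |perturbedSol a b l q (k * T + m) s| ≤
      C * ‖amplitude a b l q μ τ k s‖ := by
  obtain ⟨C, hC, h⟩ := perturbedSol_growth a b l q Q hq
  have hn : ‖μ‖ = 1 := by
    have := congrArg norm hμ
    rw [norm_mul, RCLike.norm_conj, norm_one] at this
    nlinarith [norm_nonneg μ]
  have hτ0 : 0 < ‖τ - conj τ‖ := norm_pos_iff.2 hτ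
  let D : ℝ := (2 * ‖τ‖ + 2) / ‖τ - conj τ‖
  have hD : 0 ≤ D := by positivity
  refine ⟨C ^ T * D, by positivity, fun k s m hm => ?_⟩
  obtain ⟨h0, h1⟩ := perturbedSol_eq_amplitude a b l q μ τ hμ hτ k s
  set y := amplitude a b l q μ τ k s
  have b0 : |perturbedSol a b l q (k * T) s| ≤ 2 * ‖τ‖ / ‖τ - conj τ‖ * ‖y‖ := by
    rw [← Real.norm_eq_abs, ← Complex.norm_real, h0, norm_div, div_mul_eq_mul_div]
    gcongr
    refine (norm_sub_le _ _).trans (le_of_eq ?_)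
    simp only [norm_mul, norm_pow, RCLike.norm_conj, hn]
    ring
  have b1 : |perturbedSol a b l q (k * T + 1) s| ≤ 2 / ‖τ - conj τ‖ * ‖y‖ := by
    rw [← Real.norm_eq_abs, ← Complex.norm_real, h1, norm_div, div_mul_eq_mul_div]
    gcongr
    refine (norm_sub_le _ _).trans (le_of_eq ?_)
    simp only [norm_mul, norm_pow, RCLike.norm_conj, hn]
    ring
  calc _ ≤ C ^ m * (|perturbedSol a b l q (k * T) s| + |perturbedSol a b l q (k * T + 1) s|) :=
        h _ _ _
    _ ≤ C ^ T * (D * ‖y‖) := by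
        gcongr
        simp only [D, add_div, add_mul]
        linarith
    _ = _ := by ring

/-- Variation of constants over part of the `k`-th period. -/
theorem perturbedSol_variation (a b : ZMod T → ℝ) (ha : ∀ i, 0 < a i) (l : ℝ) (q : ℕ → ℝ)
    (s : ℝ × ℝ) (k n : ℕ) :
    ![(perturbedSol a b l q (k * T + n) s : ℂ), (perturbedSol a b l q (k * T + n + 1) s : ℂ)] =
      transferProd a b l 0 n *ᵥ
        ![(perturbedSol a b l q (k * T) s : ℂ), (perturbedSol a b l q (k * T + 1) s : ℂ)]
      - ∑ m ∈ Finset.range n,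
        ((q (k * T + m + 1) * perturbedSol a b l q (k * T + m + 1) s
          / a ((m + 1 : ℕ) : ZMod T) : ℝ) : ℂ) •
          (transferProd a b l (m + 1) (n - 1 - m) *ᵥ ![0, 1]) := by
  refine transferProd_variation a b l (fun n => (perturbedSol a b l q (k * T + n) s : ℂ))
    (fun m => ((q (k * T + m + 1) * perturbedSol a b l q (k * T + m + 1) s
          / a ((m + 1 : ℕ) : ZMod T) : ℝ) : ℂ)) (fun m => ?_) n
  have h := perturbedSol_rec a b ha l q (k * T + m) s
  have e1 : ((k * T + m : ℕ) : ZMod T) = (m : ZMod T) := by simp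
  have e2 : ((k * T + m + 1 : ℕ) : ZMod T) = ((m + 1 : ℕ) : ZMod T) := by simp
  rw [e1, e2] at h
  have h' := congrArg Complex.ofReal h
  push_cast at h'
  have h3 : (a ((m + 1 : ℕ) : ZMod T) : ℂ) ≠ 0 := by exact_mod_cast (ha _).ne'
  rw [transferMatrix_mulVec]
  ext i
  fin_cases i
  · simp [add_assoc]
  · simp only [Fin.mk_one, cons_val_one, cons_val_fin_one, Pi.sub_apply, Pi.smul_apply,
      smul_eq_mul, mul_one]
    push_cast at h3 ⊢
    simp only [← add_assoc]
    field_simp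
    linear_combination h'

/-! ### The increment of the amplitude over a period -/

/-- The second row of `B_m ⋯ B_1` applied to the vector `(τ, 1)`. -/
noncomputable def rightFactor (a b : ZMod T → ℝ) (l : ℝ) (τ : ℂ) (m : ℕ) : ℂ :=
  transferProd a b l 0 m 1 0 * τ + transferProd a b l 0 m 1 1

/-- The functional `(-1, τ)` applied to the second column of `B_T ⋯ B_{m+2}`. -/
noncomputable def leftFactor (a b : ZMod T → ℝ) (l : ℝ) (τ : ℂ) (m : ℕ) : ℂ :=
  -transferProd a b l (m + 1) (T - 1 - m) 0 1 + transferProd a b l (m + 1) (T - 1 - m) 1 1 * τ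

/-- The perturbation changes the amplitude only through the values of the potential on the period. -/
theorem amplitude_increment (a b : ZMod T → ℝ) (ha : ∀ i, 0 < a i) (l : ℝ) (q : ℕ → ℝ) (μ τ : ℂ)
    (hμ : μ * conj μ = 1)
    (hl0 : -monodromy a b l 0 0 + τ * monodromy a b l 1 0 = -conj μ)
    (hl1 : -monodromy a b l 0 1 + τ * monodromy a b l 1 1 = conj μ * τ) (k : ℕ) (s : ℝ × ℝ) :
    amplitude a b l q μ τ (k + 1) s - amplitude a b l q μ τ k s =
      -∑ m ∈ Finset.range T, μ ^ (k + 1) * leftFactor a b l τ m *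
        ((q (k * T + m + 1) * perturbedSol a b l q (k * T + m + 1) s
          / a ((m + 1 : ℕ) : ZMod T) : ℝ) : ℂ) := by
  have h := perturbedSol_variation a b ha l q s k T
  have h0 := congrFun h 0
  have h1 := congrFun h 1
  rw [show transferProd a b (l : ℂ) 0 T = monodromy a b l from rfl] at h0 h1
  simp only [Pi.sub_apply, Finset.sum_apply, Pi.smul_apply, smul_eq_mul, mulVec,
    dotProduct, Fin.sum_univ_two, cons_val_zero, cons_val_one, cons_val_fin_one, mul_zero, mul_one,
    zero_add] at h0 h1
  rw [amplitude_apply, amplitude_apply, show (k + 1) * T = k * T + T by ring, h0, h1,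
    Finset.sum_congr rfl fun m _ => show μ ^ (k + 1) * leftFactor a b l τ m *
        ((q (k * T + m + 1) * perturbedSol a b l q (k * T + m + 1) s
          / a ((m + 1 : ℕ) : ZMod T) : ℝ) : ℂ) =
      -μ ^ (k + 1) * (((q (k * T + m + 1) * perturbedSol a b l q (k * T + m + 1) s
          / a ((m + 1 : ℕ) : ZMod T) : ℝ) : ℂ) * transferProd a b l (m + 1) (T - 1 - m) 0 1) +
      μ ^ (k + 1) * τ * (((q (k * T + m + 1) * perturbedSol a b l q (k * T + m + 1) s
          / a ((m + 1 : ℕ) : ZMod T) : ℝ) : ℂ) * transferProd a b l (m + 1) (T - 1 - m) 1 1) by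
      rw [leftFactor]; ring]
  rw [Finset.sum_add_distrib, ← Finset.mul_sum, ← Finset.mul_sum]
  linear_combination (μ ^ (k + 1) * (perturbedSol a b l q (k * T) s : ℂ)) * hl0 +
    (μ ^ (k + 1) * (perturbedSol a b l q (k * T + 1) s : ℂ)) * hl1 +
    (μ ^ k * (-(perturbedSol a b l q (k * T) s : ℂ)
      + τ * (perturbedSol a b l q (k * T + 1) s : ℂ))) * hμ

/-- On the `k`-th period a solution follows the unperturbed solution with the same initial data up to a
relative error of order `1 / k`. -/
theorem perturbedSol_approx [NeZero T] (a b : ZMod T → ℝ) (ha : ∀ i, 0 < a i) (l : ℝ) (q : ℕ → ℝ)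
    (Q : ℝ) (hQ : 0 ≤ Q) (hq : ∀ n : ℕ, |q n| ≤ Q / n) (μ τ : ℂ) (hμ : μ * conj μ = 1)
    (hτ : τ - conj τ ≠ 0) (C₁ : ℝ) (hC₁ : 0 ≤ C₁)
    (hC : ∀ k s, ∀ m ≤ T, |perturbedSol a b l q (k * T + m) s| ≤
      C₁ * ‖amplitude a b l q μ τ k s‖) (m : ℕ) (hm : m < T) :
    ∃ C : ℝ, 0 ≤ C ∧ ∀ k ≥ 1, ∀ s, ‖(perturbedSol a b l q (k * T + m + 1) s : ℂ) -
      (conj μ ^ k * amplitude a b l q μ τ k s * conj (rightFactor a b l τ m)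
        - μ ^ k * conj (amplitude a b l q μ τ k s) * rightFactor a b l τ m) / (τ - conj τ)‖
      ≤ C / k * ‖amplitude a b l q μ τ k s‖ := by
  refine ⟨∑ j ∈ Finset.range m, Q * C₁ / a ((j + 1 : ℕ) : ZMod T) *
    ‖transferProd a b (l : ℂ) (j + 1) (m - 1 - j) 1 1‖, Finset.sum_nonneg fun j _ => ?_,
    fun k hk s => ?_⟩
  · have := ha ((j + 1 : ℕ) : ZMod T)
    positivity
  have hk0 : (0 : ℝ) < k := by exact_mod_cast hk
  have h1 := congrFun (perturbedSol_variation a b ha l q s k m) 1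
  simp only [Pi.sub_apply, Finset.sum_apply, Pi.smul_apply, smul_eq_mul, mulVec,
    dotProduct, Fin.sum_univ_two, cons_val_zero, cons_val_one, cons_val_fin_one, mul_zero, mul_one,
    zero_add] at h1
  obtain ⟨e0, e1⟩ := perturbedSol_eq_amplitude a b l q μ τ hμ hτ k s
  set y := amplitude a b l q μ τ k s
  have hfree : transferProd a b (l : ℂ) 0 m 1 0 * (perturbedSol a b l q (k * T) s : ℂ) +
      transferProd a b (l : ℂ) 0 m 1 1 * (perturbedSol a b l q (k * T + 1) s : ℂ) =
      (conj μ ^ k * y * conj (rightFactor a b l τ m)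
        - μ ^ k * conj y * rightFactor a b l τ m) / (τ - conj τ) := by
    rw [e0, e1, rightFactor]
    simp only [map_add, map_mul, conj_transferProd]
    field_simp
    ring
  rw [h1, hfree, sub_sub_cancel_left, norm_neg, Finset.sum_div, Finset.sum_mul]
  refine (norm_sum_le _ _).trans (Finset.sum_le_sum fun j hj => ?_)
  have hj' := Finset.mem_range.1 hj
  have haj := ha ((j + 1 : ℕ) : ZMod T)
  rw [norm_mul, Complex.norm_real, Real.norm_eq_abs, abs_div, abs_mul, abs_of_pos haj]
  have hqk : |q (k * T + j + 1)| ≤ Q / k := by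
    refine (hq _).trans ?_
    have : k ≤ k * T + j + 1 := by nlinarith [NeZero.one_le (n := T)]
    gcongr
  have hs : |perturbedSol a b l q (k * T + j + 1) s| ≤ C₁ * ‖y‖ := by
    rw [add_assoc]; exact hC k s (j + 1) (by omega)
  calc _ ≤ Q / k * (C₁ * ‖y‖) / a ((j + 1 : ℕ) : ZMod T) *
        ‖transferProd a b (l : ℂ) (j + 1) (m - 1 - j) 1 1‖ := by gcongr
    _ = _ := by ring

/-- The leading term, of order `1 / k`, of the increment of the amplitude. -/
theorem amplitude_increment_approx [NeZero T] (a b : ZMod T → ℝ) (ha : ∀ i, 0 < a i) (l : ℝ)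
    (c : ℝ) (S q : ℕ → ℝ) (hS : ∀ n, |S n| ≤ 1) (hqS : ∀ n : ℕ, q n = c * S n / n) (μ τ : ℂ)
    (hμ : μ * conj μ = 1) (hτ : τ - conj τ ≠ 0)
    (hl0 : -monodromy a b l 0 0 + τ * monodromy a b l 1 0 = -conj μ)
    (hl1 : -monodromy a b l 0 1 + τ * monodromy a b l 1 1 = conj μ * τ) :
    ∃ C : ℝ, ∀ k ≥ 1, ∀ s,
      ‖amplitude a b l q μ τ (k + 1) s - amplitude a b l q μ τ k s
        - (1 / (k : ℂ)) * ∑ m ∈ Finset.range T, -(μ ^ (k + 1) * leftFactor a b l τ m *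
          (c * S (k * T + m + 1) / (T * a ((m + 1 : ℕ) : ZMod T))) *
          ((conj μ ^ k * amplitude a b l q μ τ k s * conj (rightFactor a b l τ m)
            - μ ^ k * conj (amplitude a b l q μ τ k s) * rightFactor a b l τ m) / (τ - conj τ)))‖
      ≤ C / (k : ℝ) ^ 2 * ‖amplitude a b l q μ τ k s‖ := by
  have hq : ∀ n : ℕ, |q n| ≤ |c| / n := fun n => by
    rw [hqS, abs_div, abs_mul, Nat.abs_cast]
    gcongr
    exact mul_le_of_le_one_right (abs_nonneg _) (hS n)
  have hq' : ∀ n : ℕ, |q n| ≤ |c| := fun n => by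
    refine (hq n).trans ?_
    rcases Nat.eq_zero_or_pos n with rfl | hn
    · simp
    · exact div_le_self (abs_nonneg _) (by exact_mod_cast hn)
  have hn : ‖μ‖ = 1 := by
    have := congrArg norm hμ
    rw [norm_mul, RCLike.norm_conj, norm_one] at this
    nlinarith [norm_nonneg μ]
  obtain ⟨C₁, hC₁, hC⟩ := perturbedSol_le_amplitude a b l q |c| hq' μ τ hμ hτ
  choose! C₂ hC₂0 hC₂ using
    perturbedSol_approx a b ha l q |c| (abs_nonneg c) hq μ τ hμ hτ C₁ hC₁ hC
  refine ⟨∑ m ∈ Finset.range T, ‖leftFactor a b l τ m‖ * |c| / a ((m + 1 : ℕ) : ZMod T) *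
    (T * C₁ + C₂ m), fun k hk s => ?_⟩
  have hk0 : (0 : ℝ) < k := by exact_mod_cast hk
  have hT0 : (1 : ℝ) ≤ T := by exact_mod_cast NeZero.one_le (n := T)
  rw [amplitude_increment a b ha l q μ τ hμ hl0 hl1, Finset.mul_sum, ← Finset.sum_neg_distrib,
    ← Finset.sum_sub_distrib, Finset.sum_div, Finset.sum_mul]
  refine (norm_sum_le _ _).trans (Finset.sum_le_sum fun m hm => ?_)
  have hm' := Finset.mem_range.1 hm
  have ham := ha ((m + 1 : ℕ) : ZMod T)
  have h2 := hC₂ m hm' k hk s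
  have h1 : |perturbedSol a b l q (k * T + m + 1) s| ≤
      C₁ * ‖amplitude a b l q μ τ k s‖ := by
    rw [add_assoc]; exact hC k s (m + 1) (by omega)
  set y := amplitude a b l q μ τ k s
  set g := (conj μ ^ k * y * conj (rightFactor a b l τ m)
            - μ ^ k * conj y * rightFactor a b l τ m) / (τ - conj τ)
  set p := perturbedSol a b l q (k * T + m + 1) s
  have hid : -(μ ^ (k + 1) * leftFactor a b l τ m *
        ((q (k * T + m + 1) * p / a ((m + 1 : ℕ) : ZMod T) : ℝ) : ℂ)) -
      1 / (k : ℂ) * -(μ ^ (k + 1) * leftFactor a b l τ m *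
          (c * S (k * T + m + 1) / (T * a ((m + 1 : ℕ) : ZMod T))) * g) =
      μ ^ (k + 1) * leftFactor a b l τ m * (c / a ((m + 1 : ℕ) : ZMod T)) * S (k * T + m + 1) *
        (((1 / (k * T) - 1 / ((k * T + m + 1 : ℕ) : ℝ) : ℝ) : ℂ) * p - 1 / (k * T) * (p - g)) := by
    rw [hqS]
    push_cast
    ring
  have hd : |1 / ((k : ℝ) * T) - 1 / ((k * T + m + 1 : ℕ) : ℝ)| ≤ T / (k : ℝ) ^ 2 := by
    have hm2 : (m : ℝ) + 1 ≤ T := by exact_mod_cast hm'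
    have hkT : (0 : ℝ) < k * T := by positivity
    have hm0 : (0 : ℝ) ≤ m := Nat.cast_nonneg m
    have e : 1 / ((k : ℝ) * T) - 1 / ((k * T + m + 1 : ℕ) : ℝ) =
        (m + 1) / (k * T * (k * T + m + 1)) := by
      push_cast
      field_simp
      ring
    rw [e, abs_of_nonneg (by positivity)]
    gcongr
    nlinarith [mul_le_mul_of_nonneg_left hT0 hk0.le, mul_le_mul hT0 hT0 zero_le_one (by positivity)]
  have hb : ‖((1 / (k * T) - 1 / ((k * T + m + 1 : ℕ) : ℝ) : ℝ) : ℂ) * p - 1 / (k * T) * (p - g)‖ ≤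
      (T * C₁ + C₂ m) / (k : ℝ) ^ 2 * ‖y‖ := by
    refine (norm_sub_le _ _).trans ?_
    rw [norm_mul, norm_mul, Complex.norm_real, Complex.norm_real, Real.norm_eq_abs,
      Real.norm_eq_abs, norm_div, norm_one, norm_mul, Complex.norm_natCast, Complex.norm_natCast]
    have h3 : 1 / ((k : ℝ) * T) ≤ 1 / k := by
      gcongr
      nlinarith
    calc _ ≤ T / (k : ℝ) ^ 2 * (C₁ * ‖y‖) + 1 / k * (C₂ m / k * ‖y‖) := by gcongr
      _ = _ := by ring
  rw [hid, norm_mul, norm_mul, norm_mul, norm_mul, norm_pow, hn, one_pow, one_mul, norm_div,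
    Complex.norm_real, Complex.norm_real, Complex.norm_real, Real.norm_eq_abs, Real.norm_eq_abs,
    Real.norm_eq_abs, abs_of_pos ham]
  calc _ ≤ ‖leftFactor a b l τ m‖ * (|c| / a ((m + 1 : ℕ) : ZMod T)) * 1 *
        ((T * C₁ + C₂ m) / (k : ℝ) ^ 2 * ‖y‖) := by
        gcongr
        exact hS _
    _ = _ := by ring

/-! ### The resonant potential -/

theorem norm_pow_div_le {ζ : ℂ} (hζ : ‖ζ‖ = 1) (k : ℕ) : ‖ζ ^ k / (ζ - 1)‖ ≤ 1 / ‖ζ - 1‖ := by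
  rw [norm_div, norm_pow, hζ, one_pow]

/-- When `ωT = -2 arg μ` modulo `2π`, the part of the potential of frequency `ω` couples the amplitude to
its complex conjugate resonantly, with the coefficient that is normalized to modulus `2` here; all other
terms carry one of the oscillating factors `μ ^ (2k)`, `μ ^ (-2k)`, `μ ^ (4k)`. -/
theorem exists_decaying_amplitude [NeZero T] (a b : ZMod T → ℝ) (ha : ∀ i, 0 < a i) (l : ℝ)
    (c ω φ : ℝ) (q : ℕ → ℝ) (hq : ∀ n : ℕ, q n = c * Real.sin (n * ω + φ) / n) (μ τ : ℂ)
    (hμ : μ * conj μ = 1) (hμ2 : μ ^ 2 ≠ 1) (hμ4 : μ ^ 4 ≠ 1) (hτ : τ - conj τ ≠ 0)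
    (hω : Complex.exp (Complex.I * ω * T) = conj μ ^ 2)
    (hl0 : -monodromy a b l 0 0 + τ * monodromy a b l 1 0 = -conj μ)
    (hl1 : -monodromy a b l 0 1 + τ * monodromy a b l 1 1 = conj μ * τ)
    (hβ : ‖c * (μ / (2 * Complex.I * T * (τ - conj τ)) * ∑ m ∈ Finset.range T,
      leftFactor a b l τ m * rightFactor a b l τ m * Complex.exp (Complex.I * ((m + 1) * ω + φ))
        / a ((m + 1 : ℕ) : ZMod T))‖ = 2) :
    ∃ s : ℝ × ℝ, s ≠ 0 ∧ ∃ (C : ℝ) (K : ℕ), ∀ k ≥ K, ‖amplitude a b l q μ τ k s‖ ≤ C / k := by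
  have hn : ‖μ‖ = 1 := by
    have := congrArg norm hμ
    rw [norm_mul, RCLike.norm_conj, norm_one] at this
    nlinarith [norm_nonneg μ]
  let f : ℕ → ℂ := fun m => Complex.exp (Complex.I * ((m + 1) * ω + φ))
  let L : ℂ := c * (μ / (2 * Complex.I * T * (τ - conj τ)))
  let X₁ : ℂ := ∑ m ∈ Finset.range T, leftFactor a b l τ m * conj (rightFactor a b l τ m) * f m
        / a ((m + 1 : ℕ) : ZMod T)
  let X₂ : ℂ := ∑ m ∈ Finset.range T, leftFactor a b l τ m * conj (rightFactor a b l τ m) *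
        conj (f m) / a ((m + 1 : ℕ) : ZMod T)
  let Y₁ : ℂ := ∑ m ∈ Finset.range T, leftFactor a b l τ m * rightFactor a b l τ m * f m
        / a ((m + 1 : ℕ) : ZMod T)
  let Y₂ : ℂ := ∑ m ∈ Finset.range T, leftFactor a b l τ m * rightFactor a b l τ m *
        conj (f m) / a ((m + 1 : ℕ) : ZMod T)
  have hν2 : conj μ ^ 2 ≠ 1 := fun h => hμ2 (by simpa using congrArg conj h)
  have d1 : conj μ ^ 2 - 1 ≠ 0 := sub_ne_zero.2 hν2
  have d2 : μ ^ 2 - 1 ≠ 0 := sub_ne_zero.2 hμ2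
  have d4 : μ ^ 4 - 1 ≠ 0 := sub_ne_zero.2 hμ4
  -- primitives of the oscillating coefficients, by summing geometric progressions
  let A : ℕ → ℂ := fun k => -L * (X₁ * ((conj μ ^ 2) ^ k / (conj μ ^ 2 - 1))
    - X₂ * ((μ ^ 2) ^ k / (μ ^ 2 - 1)))
  let G : ℕ → ℂ := fun k => -L * Y₂ * ((μ ^ 4) ^ k / (μ ^ 4 - 1))
  let RA : ℝ := ‖L‖ * (‖X₁‖ * (1 / ‖conj μ ^ 2 - 1‖) + ‖X₂‖ * (1 / ‖μ ^ 2 - 1‖))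
  let RG : ℝ := ‖L‖ * ‖Y₂‖ * (1 / ‖μ ^ 4 - 1‖)
  have hRA : 0 ≤ RA := by positivity
  have hRG : 0 ≤ RG := by positivity
  have hA : ∀ k, ‖A k‖ ≤ RA + RG := fun k => by
    have : ‖A k‖ ≤ RA := by
      simp only [A, RA, norm_mul, norm_neg]
      refine mul_le_mul_of_nonneg_left ((norm_sub_le _ _).trans ?_) (norm_nonneg _)
      rw [norm_mul, norm_mul]
      gcongr
      · exact norm_pow_div_le (by rw [norm_pow, RCLike.norm_conj, hn, one_pow]) k
      · exact norm_pow_div_le (by rw [norm_pow, hn, one_pow]) k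
    linarith
  have hG : ∀ k, ‖G k‖ ≤ RA + RG := fun k => by
    have : ‖G k‖ ≤ RG := by
      simp only [G, RG, norm_mul, norm_neg]
      gcongr
      exact norm_pow_div_le (by rw [norm_pow, hn, one_pow]) k
    linarith
  have hAd : ∀ k, A (k + 1) - A k = -L * (X₁ * (conj μ ^ 2) ^ k - X₂ * (μ ^ 2) ^ k) := fun k => by
    simp only [A, pow_succ _ k]
    field_simp
    ring
  have hGd : ∀ k, G (k + 1) - G k = -L * Y₂ * (μ ^ 4) ^ k := fun k => by
    simp only [G, pow_succ _ k]
    field_simp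
    ring
  obtain ⟨C, hC⟩ := amplitude_increment_approx a b ha l c (fun n => Real.sin (n * ω + φ)) q
    (fun n => Real.abs_sin_le_one _) hq μ τ hμ hτ hl0 hl1
  refine exists_decaying_of_oscillating (amplitude a b l q μ τ) (L * Y₁)
    (by rw [← hβ]; congr 1; simp only [L, Y₁, f]; ring) A G (RA + RG) hA hG C fun k hk s => ?_
  refine le_trans (le_of_eq ?_) (hC k hk s)
  set y := amplitude a b l q μ τ k s
  congr 3
  rw [hAd, hGd]
  have hk1 : μ ^ k * conj μ ^ k = 1 := by rw [← mul_pow, hμ, one_pow]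
  have hsin : ∀ m : ℕ, ((Real.sin (((k * T + m + 1 : ℕ) : ℝ) * ω + φ) : ℝ) : ℂ) =
      ((conj μ ^ 2) ^ k * f m - (μ ^ 2) ^ k * conj (f m)) / (2 * Complex.I) := fun m => by
    have e1 : (conj μ ^ 2) ^ k * f m =
        Complex.exp (((((k * T + m + 1 : ℕ) : ℝ) * ω + φ : ℝ) : ℂ) * Complex.I) := by
      rw [← hω, ← Complex.exp_nat_mul, ← Complex.exp_add]
      congr 1
      push_cast
      ring
    have e2 : (μ ^ 2) ^ k * conj (f m) =
        Complex.exp (-((((k * T + m + 1 : ℕ) : ℝ) * ω + φ : ℝ) : ℂ) * Complex.I) := by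
      have := congrArg conj e1
      rw [← Complex.exp_conj] at this
      rw [map_mul, map_pow, map_pow, Complex.conj_conj] at this
      rw [this, map_mul, Complex.conj_ofReal, Complex.conj_I]
      congr 1
      ring
    rw [e1, e2, Complex.ofReal_sin, Complex.sin]
    field_simp
    rw [Complex.I_sq]
    ring
  have hterm : ∀ m, -(μ ^ (k + 1) * leftFactor a b l τ m *
      (c * (Real.sin (((k * T + m + 1 : ℕ) : ℝ) * ω + φ) : ℝ) / (T * a ((m + 1 : ℕ) : ZMod T))) *
        ((conj μ ^ k * y * conj (rightFactor a b l τ m)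
            - μ ^ k * conj y * rightFactor a b l τ m) / (τ - conj τ))) =
      -L * (conj μ ^ 2) ^ k * y * (leftFactor a b l τ m * conj (rightFactor a b l τ m) * f m
        / a ((m + 1 : ℕ) : ZMod T))
      + L * (μ ^ 2) ^ k * y * (leftFactor a b l τ m * conj (rightFactor a b l τ m) * conj (f m)
        / a ((m + 1 : ℕ) : ZMod T))
      + L * conj y * (leftFactor a b l τ m * rightFactor a b l τ m * f m
        / a ((m + 1 : ℕ) : ZMod T))
      - L * (μ ^ 4) ^ k * conj y * (leftFactor a b l τ m * rightFactor a b l τ m * conj (f m)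
        / a ((m + 1 : ℕ) : ZMod T)) := fun m => by
    rw [hsin]
    simp only [L]
    generalize τ - conj τ = δ
    linear_combination (c * (μ / (2 * Complex.I * T * δ)) * leftFactor a b l τ m
      / a ((m + 1 : ℕ) : ZMod T)) *
      (-(conj μ ^ k) ^ 2 * f m * y * conj (rightFactor a b l τ m)
        + (μ ^ k * conj μ ^ k + 1) * f m * conj y * rightFactor a b l τ m
        + (μ ^ k) ^ 2 * conj (f m) * y * conj (rightFactor a b l τ m)) * hk1
  rw [Finset.sum_congr rfl fun m _ => hterm m, Finset.sum_sub_distrib, Finset.sum_add_distrib,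
    Finset.sum_add_distrib, ← Finset.mul_sum, ← Finset.mul_sum, ← Finset.mul_sum, ← Finset.mul_sum]
  simp only [X₁, X₂, Y₁, Y₂]
  ring

/-! ### The eigenvector -/

/-- The resonance coefficient is a multiple of the sum that couples the amplitude to its conjugate. The
product index is `m = T - 1 - j`. If `p₂ = 0` or `μ = p₁`, the prefactor is zero, by the convention
`x / 0 = 0` in the first case. -/
theorem resonanceCoeff_eq (a b : ZMod T → ℝ)
    (l θ ω φ : ℝ) (μ τ : ℂ) (hμ : μ = Complex.exp (Complex.I * θ))
    (hτ : τ = monodromy a b l 0 1 / (μ - monodromy a b l 0 0)) :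
    resonanceCoeff a b l θ ω φ =
      (‖μ - monodromy a b l 0 0‖ : ℂ) ^ 2 * μ / (4 * T * monodromy a b l 0 1) *
      ∑ m ∈ Finset.range T,
      leftFactor a b l τ m * rightFactor a b l τ m * Complex.exp (Complex.I * ((m + 1) * ω + φ))
        / a ((m + 1 : ℕ) : ZMod T) := by
  rw [resonanceCoeff, ← Finset.sum_range_reflect, Finset.mul_sum]
  refine Finset.sum_congr rfl fun m hm => ?_
  have hm' := Finset.mem_range.1 hm
  have e1 : T - (T - 1 - m) = m + 1 := by omega
  have e3 : ((T : ℝ) - ((T - 1 - m : ℕ) : ℝ)) = m + 1 := by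
    rw [show T - 1 - m = T - (m + 1) by omega, Nat.cast_sub (by omega)]
    push_cast; ring
  simp only [coeffE, coeffD, e1, e3, Nat.add_sub_cancel, ← hμ, ← hτ, leftFactor, rightFactor]
  push_cast
  ring

/-- A solution that is `O(1/k)` on the `k`-th period is square summable. -/
theorem memlp_perturbedSol [NeZero T] (a b : ZMod T → ℝ) (l : ℝ) (q : ℕ → ℝ) (Q : ℝ)
    (hq : ∀ n, |q n| ≤ Q) (μ τ : ℂ) (hμ : μ * conj μ = 1) (hτ : τ - conj τ ≠ 0) (s : ℝ × ℝ)
    (C : ℝ) (K : ℕ) (h : ∀ k ≥ K, ‖amplitude a b l q μ τ k s‖ ≤ C / k) :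
    Memℓp (fun n => (perturbedSol a b l q n s : ℂ)) 2 := by
  obtain ⟨C₁, hC₁, hC⟩ := perturbedSol_le_amplitude a b l q Q hq μ τ hμ hτ
  have h0 : (0 : ℝ) < (2 : ENNReal).toReal := by norm_num
  rw [memℓp_gen_iff h0]
  have hT := NeZero.pos T
  have hT0 : (0 : ℝ) < T := by exact_mod_cast hT
  have hbound : ∀ n ≥ (K + 1) * T,
      ‖(perturbedSol a b l q n s : ℂ)‖ ≤ C₁ * |C| * (2 * T) / n := by
    intro n hn
    have hk : K + 1 ≤ n / T := (Nat.le_div_iff_mul_le hT).2 hn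
    have hk1 : (1 : ℝ) ≤ (n / T : ℕ) := by exact_mod_cast (show 1 ≤ n / T by omega)
    have hn0 : (0 : ℝ) < n := by
      have : 0 < (K + 1) * T := by positivity
      exact_mod_cast this.trans_le hn
    have hnT : (n : ℝ) ≤ 2 * T * (n / T : ℕ) := by
      have h1 : n < T * (n / T + 1) := Nat.lt_mul_div_succ n hT
      have h2 : (n : ℝ) ≤ T * ((n / T : ℕ) + 1) := by exact_mod_cast h1.le
      nlinarith
    have h1 := hC (n / T) s (n % T) (Nat.mod_lt n hT).le
    rw [Nat.div_add_mod'] at h1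
    rw [Complex.norm_real, Real.norm_eq_abs]
    calc _ ≤ C₁ * (|C| / (n / T : ℕ)) := by
          refine h1.trans (mul_le_mul_of_nonneg_left ((h _ (by omega)).trans ?_) hC₁)
          gcongr
          exact le_abs_self C
      _ ≤ C₁ * (|C| * (2 * T) / n) := by
          refine mul_le_mul_of_nonneg_left ?_ hC₁
          rw [div_le_div_iff₀ (by linarith) hn0]
          calc _ ≤ |C| * (2 * T * (n / T : ℕ)) := by gcongr
            _ = _ := by ring
      _ = _ := by ring
  have hsum : Summable fun n : ℕ => (C₁ * |C| * (2 * T)) ^ 2 * (1 / (n : ℝ) ^ 2) :=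
    (Real.summable_one_div_nat_pow.2 one_lt_two).mul_left _
  refine (summable_nat_add_iff ((K + 1) * T)).1 (Summable.of_nonneg_of_le (fun n => by positivity)
    (fun n => ?_) ((summable_nat_add_iff ((K + 1) * T)).2 hsum))
  have h1 := hbound (n + (K + 1) * T) (by omega)
  have e2 : (2 : ENNReal).toReal = ((2 : ℕ) : ℝ) := by norm_num
  rw [e2, Real.rpow_natCast]
  calc _ ≤ (C₁ * |C| * (2 * T) / (n + (K + 1) * T : ℕ)) ^ 2 := by gcongr
    _ = _ := by ring

theorem memlp_of_tail {u : ℕ → ℂ} (h : Memℓp (fun n => u (n + 1)) 2) : Memℓp u 2 := by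
  have h0 : (0 : ℝ) < (2 : ENNReal).toReal := by norm_num
  rw [memℓp_gen_iff h0] at h ⊢
  exact (summable_nat_add_iff 1).1 h

/-- A nonzero square summable solution of the recurrence far out gives an eigenvector: the first two
values of the potential and the first entry of the vector are free, and fit the two equations at the
boundary. -/
theorem exists_hasEigenvalue_of_tail [NeZero T] (a b : ZMod T → ℝ) (ha : ∀ i, 0 < a i) (l : ℝ)
    (c ω φ : ℝ) (u : ℕ → ℝ) (hmem : Memℓp (fun n => (u n : ℂ)) 2)
    (hne : u 2 ≠ 0 ∨ u 3 ≠ 0)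
    (hrec : ∀ n : ℕ, a ((n + 2 : ℕ) : ZMod T) * u (n + 2)
      + (b ((n + 3 : ℕ) : ZMod T) + c * Real.sin ((n + 3 : ℕ) * ω + φ) / (n + 3 : ℕ)) * u (n + 3)
      + a ((n + 3 : ℕ) : ZMod T) * u (n + 4) = l * u (n + 3)) :
    ∃ q₁ q₂ : ℝ, Module.End.HasEigenvalue (periodicJacobi a b + potentialOp c ω φ q₁ q₂) (l : ℂ) := by
  obtain ⟨x, q₁, q₂, h1, h2⟩ : ∃ x q₁ q₂ : ℝ,
      (b ((1 : ℕ) : ZMod T) + q₁) * x + a ((1 : ℕ) : ZMod T) * u 2 = l * x ∧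
      a ((1 : ℕ) : ZMod T) * x + (b ((2 : ℕ) : ZMod T) + q₂) * u 2 + a ((2 : ℕ) : ZMod T) * u 3
        = l * u 2 := by
    by_cases hu : u 2 = 0
    · refine ⟨-(a ((2 : ℕ) : ZMod T) * u 3 / a ((1 : ℕ) : ZMod T)), l - b ((1 : ℕ) : ZMod T), 0,
        ?_, ?_⟩
      · rw [hu]; ring
      · rw [hu, mul_neg, mul_div_cancel₀ _ (ha _).ne']; ring
    · refine ⟨1, l - b ((1 : ℕ) : ZMod T) - a ((1 : ℕ) : ZMod T) * u 2, l - b ((2 : ℕ) : ZMod T) -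
        (a ((1 : ℕ) : ZMod T) + a ((2 : ℕ) : ZMod T) * u 3) / u 2, by ring, ?_⟩
      field_simp
      ring
  refine ⟨q₁, q₂, ?_⟩
  let v : ℕ → ℂ := fun n => if n = 0 then (x : ℂ) else (u (n + 1) : ℂ)
  have hv : Memℓp v 2 := memlp_of_tail (by
    simpa [v, add_assoc] using memlp_tail (memlp_tail hmem))
  refine Module.End.hasEigenvalue_of_hasEigenvector (x := (⟨v, hv⟩ : EllTwo)) ⟨?_, ?_⟩
  · rw [Module.End.mem_eigenspace_iff]
    ext n
    change ((if n = 0 then 0 else (a (n : ZMod T) : ℂ) * v (n - 1))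
        + (b ((n + 1 : ℕ) : ZMod T) : ℂ) * v n + (a ((n + 1 : ℕ) : ZMod T) : ℂ) * v (n + 1))
      + (potential c ω φ q₁ q₂ (n + 1) : ℂ) * v n = (l : ℂ) * v n
    match n with
    | 0 =>
      have h := congrArg Complex.ofReal h1
      push_cast at h
      simp [v, potential]
      linear_combination h
    | 1 =>
      have h := congrArg Complex.ofReal h2
      push_cast at h
      simp [v, potential]
      linear_combination h
    | n + 2 =>
      have h := congrArg Complex.ofReal (hrec n)
      have e : potential c ω φ q₁ q₂ (n + 2 + 1) =
          c * Real.sin ((n + 3 : ℕ) * ω + φ) / (n + 3 : ℕ) := by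
        rw [potential, if_neg (by omega), if_neg (by omega)]
      rw [e]
      simp only [v, Nat.add_eq_zero_iff, OfNat.ofNat_ne_zero, one_ne_zero, and_false, if_false,
        show n + 2 - 1 = n + 1 from rfl,
        show n + 2 + 1 = n + 3 from rfl, show n + 3 + 1 = n + 4 from rfl,
        show n + 1 + 1 = n + 2 from rfl]
      push_cast at h ⊢
      linear_combination h
  · intro h
    have hz : ∀ n, v n = 0 := fun n => congrFun (congrArg Subtype.val h) n
    have z1 : u 2 = 0 := by simpa [v] using hz 1
    have z2 : u 3 = 0 := by simpa [v] using hz 2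
    exact hne.elim (· z1) (· z2)

end JacobiWvN

open ComplexConjugate in
theorem theorem3 (T : ℕ) [NeZero T] (a b : ZMod T → ℝ) (ha : ∀ i, 0 < a i)
    (lam : ℂ) (hlam : lam ∈ JacobiWvN.ellipticPoints a b)
    (θ : ℝ) (hθ : JacobiWvN.IsQuasiMomentum a b lam θ) (hθ' : θ ≠ Real.pi / 2)
    (ω : ℝ) (k : ℤ) (hω : ω * T + 2 * θ = 2 * Real.pi * k) (φ : ℝ)
    (hE : JacobiWvN.resonanceCoeff a b lam θ ω φ ≠ 0) :
    ∃ c q₁ q₂ : ℝ, c ≠ 0 ∧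
      Module.End.HasEigenvalue
        (JacobiWvN.periodicJacobi a b + JacobiWvN.potentialOp c ω φ q₁ q₂) lam := by
  open JacobiWvN in
  obtain ⟨hθ0, hθπ, hev₁, hev₂⟩ := hθ
  obtain ⟨μ, hμdef⟩ : ∃ μ : ℂ, μ = Complex.exp (Complex.I * θ) := ⟨_, rfl⟩
  have hμc : conj μ = Complex.exp (-(Complex.I * θ)) := by
    rw [hμdef, ← Complex.exp_conj]; simp
  have hμ : μ * conj μ = 1 := by rw [hμc, hμdef, ← Complex.exp_add]; simp
  have hμn : ‖μ‖ = 1 := by rw [hμdef, mul_comm]; exact Complex.norm_exp_ofReal_mul_I θ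
  rw [← hμdef] at hev₁
  rw [← hμc] at hev₂
  obtain ⟨l, rfl⟩ : ∃ l : ℝ, lam = l :=
    ⟨lam.re, (Complex.conj_eq_iff_re.1 (conj_eq_of_monodromy_eigenvalue a b ha lam μ hμn hev₁)).symm⟩
  have hsinθ : 0 < Real.sin θ := Real.sin_pos_of_pos_of_lt_pi hθ0 hθπ
  have hre : μ.re = Real.cos θ := by rw [hμdef, mul_comm, Complex.exp_ofReal_mul_I_re]
  have him : μ.im = Real.sin θ := by rw [hμdef, mul_comm, Complex.exp_ofReal_mul_I_im]
  have hμne : μ - conj μ ≠ 0 := fun h => by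
    have := congrArg Complex.im h
    simp [him] at this
    linarith
  have hμ2 : μ ^ 2 ≠ 1 := fun h => hμne (by
    have : μ ^ 2 * conj μ = conj μ := by rw [h, one_mul]
    linear_combination this - μ * hμ)
  have hμ2' : μ ^ 2 ≠ -1 := fun h => by
    have h1 := congrArg Complex.im h
    simp only [sq, Complex.mul_im, hre, him, Complex.neg_im, Complex.one_im] at h1
    have h2 : Real.cos θ = 0 := by
      have : Real.cos θ * Real.sin θ = 0 := by linarith
      exact (mul_eq_zero.1 this).resolve_right hsinθ.ne'
    exact hθ' (Real.injOn_cos ⟨hθ0.le, hθπ.le⟩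
      ⟨by positivity, by linarith [Real.pi_pos]⟩ (by rw [h2, Real.cos_pi_div_two]))
  have hμ4 : μ ^ 4 ≠ 1 := fun h => by
    have : (μ ^ 2 - 1) * (μ ^ 2 + 1) = 0 := by linear_combination h
    rcases mul_eq_zero.1 this with h1 | h1
    · exact hμ2 (by linear_combination h1)
    · exact hμ2' (by linear_combination h1)
  have hM : ∀ i j, conj (monodromy a b l i j) = monodromy a b l i j :=
    fun i j => conj_transferProd a b l 0 T i j
  have hd₁ := det_sub_smul_eq_zero_of_hasEigenvalue _ _ hev₁
  have hd₂ := det_sub_smul_eq_zero_of_hasEigenvalue _ _ hev₂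
  obtain ⟨τ, hτdef⟩ : ∃ τ, τ = monodromy a b l 0 1 / (μ - monodromy a b l 0 0) := ⟨_, rfl⟩
  rw [resonanceCoeff_eq a b l θ ω φ μ τ hμdef hτdef] at hE
  -- the prefactor is nonzero only if `p₂` and `μ - p₁` are
  obtain ⟨hpre, hY⟩ := mul_ne_zero_iff.1 hE
  set p₁ := monodromy a b l 0 0
  set p₂ := monodromy a b l 0 1
  set p₃ := monodromy a b l 1 0
  set p₄ := monodromy a b l 1 1
  have hp₂ : p₂ ≠ 0 := by rintro h; simp [h] at hpre
  have hp₁ : μ - p₁ ≠ 0 := by rintro h; simp [h] at hpre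
  have hp₁' : conj μ - p₁ ≠ 0 := fun h => hp₁ (by
    have := congrArg conj h
    simpa [p₁, hM] using this)
  have htr : p₁ + p₄ = μ + conj μ := by
    have : (μ - conj μ) * (μ + conj μ - (p₁ + p₄)) = 0 := by linear_combination hd₁ - hd₂
    have := (mul_eq_zero.1 this).resolve_left hμne
    linear_combination -this
  have hdet : p₁ * p₄ - p₂ * p₃ = 1 := by
    linear_combination hd₁ + μ * htr + hμ
  have hτ : τ - conj τ ≠ 0 := by
    have e : conj τ = p₂ / (conj μ - p₁) := by
      rw [hτdef, map_div₀, map_sub, hM, hM]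
    rw [e, hτdef, div_sub_div _ _ hp₁ hp₁']
    refine div_ne_zero ?_ (mul_ne_zero hp₁ hp₁')
    have : p₂ * (conj μ - p₁) - (μ - p₁) * p₂ = -(p₂ * (μ - conj μ)) := by ring
    rw [this]
    exact neg_ne_zero.2 (mul_ne_zero hp₂ hμne)
  have hl0 : -p₁ + τ * p₃ = -conj μ := by
    rw [hτdef]
    field_simp
    linear_combination p₁ * htr - hdet + hμ
  have hl1 : -p₂ + τ * p₄ = conj μ * τ := by
    rw [hτdef]
    field_simp
    linear_combination htr
  have hω' : Complex.exp (Complex.I * ω * T) = conj μ ^ 2 := by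
    rw [hμc, ← Complex.exp_nat_mul, Complex.exp_eq_exp_iff_exists_int]
    refine ⟨k, ?_⟩
    have := congrArg Complex.ofReal hω
    push_cast at this ⊢
    linear_combination Complex.I * this
  set Y := ∑ m ∈ Finset.range T,
      leftFactor a b l τ m * rightFactor a b l τ m * Complex.exp (Complex.I * ((m + 1) * ω + φ))
        / a ((m + 1 : ℕ) : ZMod T) with hYdef
  obtain ⟨β, hβ⟩ : ∃ β, β = μ / (2 * Complex.I * T * (τ - conj τ)) * Y := ⟨_, rfl⟩
  have hβ0 : β ≠ 0 := by
    have h1 : μ ≠ 0 := by rintro rfl; simp at hμn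
    have h2 : (T : ℂ) ≠ 0 := by exact_mod_cast NeZero.ne T
    rw [hβ]
    exact mul_ne_zero (div_ne_zero h1 (by simp [hτ, h2])) hY
  have hβn : 0 < ‖β‖ := norm_pos_iff.2 hβ0
  -- the coupling constant for which `|β| = 2`, so that the averaged equation decays like `k ^ (-2)`
  obtain ⟨c, hc⟩ : ∃ c : ℝ, c = 2 / ‖β‖ := ⟨_, rfl⟩
  have hc0 : 0 < c := by rw [hc]; positivity
  let q : ℕ → ℝ := fun n => c * Real.sin (n * ω + φ) / n
  have hqb : ∀ n, |q n| ≤ |c| := fun n => by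
    simp only [q]
    rcases Nat.eq_zero_or_pos n with rfl | hn
    · simp
    · rw [abs_div, abs_mul, Nat.abs_cast]
      exact (div_le_self (by positivity) (by exact_mod_cast hn)).trans
        (mul_le_of_le_one_right (abs_nonneg _) (Real.abs_sin_le_one _))
  obtain ⟨s, hs0, C, K, hs⟩ := exists_decaying_amplitude a b ha l c ω φ q (fun _ => rfl) μ τ hμ hμ2
    hμ4 hτ hω' hl0 hl1 (by
      rw [← hYdef, ← hβ, norm_mul, Complex.norm_real, Real.norm_of_nonneg hc0.le, hc,
        div_mul_cancel₀ _ hβn.ne'])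
  have hmem := memlp_perturbedSol a b l q |c| hqb μ τ hμ hτ s C K hs
  obtain ⟨q₁, q₂, h⟩ := exists_hasEigenvalue_of_tail a b ha l c ω φ
    (fun n => perturbedSol a b l q n s) hmem (by
      by_contra! h0
      exact hs0 (perturbedSol_injective a b ha l q 2 s h0.1 h0.2))
    (fun n => perturbedSol_rec a b ha l q (n + 2) s)
  exact ⟨c, q₁, q₂, hc0.ne', h⟩
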